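/- Let $M$ be a connected smooth $7$-manifold with a smooth $3$-form $\varphi$ that at every point is linearly equivalent to $$\varphi_0 = e^{123}-e^1(e^{45}+e^{67})-e^2(e^{46}+e^{75})-e^3(e^{47}+e^{56})$$ on $\mathbb{R}^7$, and let $g$ and ${*}\varphi$ be the induced Riemannian metric and Hodge dual $4$-form, given in any coframe identifying $\varphi$ with $\varphi_0$ by $\sum_i (e^i)^2$ and $e^{4567}-e^{23}(e^{45}+e^{67})-e^{31}(e^{46}+e^{75})-e^{12}(e^{47}+e^{56})$. Suppose that $(M,\varphi)$ is a toric $\mathrm{G}_2$-manifold, that is: - $\varphi$ is torsion-free, i.e. $d\varphi=0$ and $d{*}\varphi=0$; - the torus $T^3$ acts smoothly and effectively on $M$, preserving $\varphi$; write $\xi\colon\mathbb{R}^3\cong\mathfrak{t}^3\to\mathfrak{X}(M)$ for the infinitesimal action; - the action is multi-Hamiltonian for both $\varphi$ and ${*}\varphi$: there are smooth $T^3$-invariant maps $\nu\colon M\to\Lambda^2(\mathfrak{t}^3)^*$ and $\mu\colon M\to\Lambda^3(\mathfrak{t}^3)^*$ such that $d\langle\nu,u\wedge v\rangle=\varphi(\xi(u),\xi(v),\cdot)$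 and $d\langle\mu,u\wedge v\wedge w\rangle={*}\varphi(\xi(u),\xi(v),\xi(w),\cdot)$ for all $u,v,w\in\mathfrak{t}^3$. Let $U_1,U_2,U_3$ be the vector fields generating the action, i.e. the images under $\xi$ of the standard basis of $\mathfrak{t}^3$, let $M_0\subset M$ be the set of points where they are linearly independent, and on $M_0$ let $V=B^{-1}$, where $B=(g(U_i,U_j))_{1\le i,j\le 3}$. If $V$ is constant on $M_0$, then $g$ is flat (its Riemann curvature tensor vanishes on all of $M$), and hence $(M,g)$ is locally isometric to $\mathbb{R}^7$ with its Euclidean metric: every point of $M$ has an open neighbourhood isometric to an open subset of $\mathbb{R}^7$. -/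

import Mathlib

open scoped Manifold ContDiff

noncomputable section

/-- The model space `ℝ⁷` with its Euclidean inner product. -/
abbrev R7 : Type := EuclideanSpace ℝ (Fin 7)

/-! ### The model forms on `ℝ⁷` -/

/-- The constant form `e^{I 0} ∧ ⋯ ∧ e^{I (k-1)}` on `ℝ⁷`, where `e^i` is the standard dual basis:
its value on `v_0, …, v_{k-1}` is the determinant of the matrix `(e^{I b}(v_a))`. -/
def basisForm {k : ℕ} (I : Fin k → Fin 7) : R7 [⋀^Fin k]→L[ℝ] ℝ where
  toMultilinearMap :=
    ((Matrix.detRowAlternating (n := Fin k) (R := ℝ)).compLinearMap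
      (LinearMap.pi fun b => (EuclideanSpace.proj (I b) : R7 →L[ℝ] ℝ).toLinearMap)).toMultilinearMap
  cont := by
    change Continuous fun v : Fin k → R7 => Matrix.det (Matrix.of fun a b => v a (I b))
    apply Continuous.matrix_det
    fun_prop
  map_eq_zero_of_eq' := by
    intro v i j h hij
    exact ((Matrix.detRowAlternating (n := Fin k) (R := ℝ)).compLinearMap
      (LinearMap.pi fun b => (EuclideanSpace.proj (I b) : R7 →L[ℝ] ℝ).toLinearMap)).map_eq_zero_of_eq v h hij

theorem basisForm_apply {k : ℕ} (I : Fin k → Fin 7) (v : Fin k → R7) :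
    basisForm I v = Matrix.det (Matrix.of fun a b => v a (I b)) := rfl

/-- The model `G₂` three-form
`e^{123} - e^1(e^{45}+e^{67}) - e^2(e^{46}+e^{75}) - e^3(e^{47}+e^{56})`
(the index `i` of the formula is `i - 1 : Fin 7`). -/
def phi0 : R7 [⋀^Fin 3]→L[ℝ] ℝ :=
  basisForm ![0, 1, 2] - (basisForm ![0, 3, 4] + basisForm ![0, 5, 6])
    - (basisForm ![1, 3, 5] + basisForm ![1, 6, 4])
    - (basisForm ![2, 3, 6] + basisForm ![2, 4, 5])

/-- The Hodge dual `*φ₀` of `phi0` for the Euclidean metric and the volume form `e^{1234567}`,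
`e^{4567} - e^{23}(e^{45}+e^{67}) - e^{31}(e^{46}+e^{75}) - e^{12}(e^{47}+e^{56})`. -/
def starPhi0 : R7 [⋀^Fin 4]→L[ℝ] ℝ :=
  basisForm ![3, 4, 5, 6] - (basisForm ![1, 2, 3, 4] + basisForm ![1, 2, 5, 6])
    - (basisForm ![2, 0, 3, 5] + basisForm ![2, 0, 6, 4])
    - (basisForm ![0, 1, 3, 6] + basisForm ![0, 1, 4, 5])

/-! ### Differential forms and metrics on 7-manifolds -/

section Forms

variable {M : Type*} [TopologicalSpace M] [ChartedSpace R7 M]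

/-- A (not necessarily smooth) differential `k`-form on a `7`-manifold. -/
abbrev DiffForm (M : Type*) [TopologicalSpace M] [ChartedSpace R7 M] (k : ℕ) : Type _ :=
  ∀ p : M, TangentSpace (𝓡 7) p [⋀^Fin k]→L[ℝ] ℝ

/-- The differential at `y` of the parametrisation of `M` by the inverse of the chart at `x`. -/
def paramDeriv (x : M) (y : R7) :
    R7 →L[ℝ] TangentSpace (𝓡 7) ((extChartAt (𝓡 7) x).symm y) :=
  mfderiv 𝓘(ℝ, R7) (𝓡 7) (extChartAt (𝓡 7) x).symm y

/-- The expression of a differential form in the chart at `x`, i.e. its pullback by the inverse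
of that chart; meaningful on the target of the chart. -/
def DiffForm.inChart {k : ℕ} (α : DiffForm M k) (x : M) (y : R7) : R7 [⋀^Fin k]→L[ℝ] ℝ :=
  (α ((extChartAt (𝓡 7) x).symm y)).compContinuousLinearMap (paramDeriv x y)

/-- A differential form is smooth if all its chart expressions are. -/
def DiffForm.IsSmooth {k : ℕ} (α : DiffForm M k) : Prop :=
  ∀ x : M, ContDiffOn ℝ ∞ (α.inChart x) (extChartAt (𝓡 7) x).target

/-- `dα = 0`: the exterior derivative of every chart expression of `α` vanishes. -/
def DiffForm.IsClosed {k : ℕ} (α : DiffForm M k) : Prop :=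
  ∀ x : M, ∀ y ∈ (extChartAt (𝓡 7) x).target, extDeriv (α.inChart x) y = 0

/-- A field of (symmetric, bilinear) products on the tangent spaces, as a plain function. -/
abbrev TangentProduct (M : Type*) [TopologicalSpace M] [ChartedSpace R7 M] : Type _ :=
  ∀ p : M, TangentSpace (𝓡 7) p → TangentSpace (𝓡 7) p → ℝ

/-- The matrix `g_{ij} = g(∂_i, ∂_j)` of a metric in the chart at `x`. -/
def metricMatrix (g : TangentProduct M) (x : M) (y : R7) : Matrix (Fin 7) (Fin 7) ℝ :=
  Matrix.of fun i j => g ((extChartAt (𝓡 7) x).symm y)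
    (paramDeriv x y (EuclideanSpace.single i 1)) (paramDeriv x y (EuclideanSpace.single j 1))

/-- The partial derivative `∂_i f` of a function on `ℝ⁷`. -/
def partialDeriv (i : Fin 7) (f : R7 → ℝ) (y : R7) : ℝ :=
  fderiv ℝ f y (EuclideanSpace.single i 1)

/-- The Christoffel symbols
`Γ^k_{ij} = ½ ∑_l g^{kl} (∂_i g_{jl} + ∂_j g_{il} - ∂_l g_{ij})` in the chart at `x`. -/
def christoffel (g : TangentProduct M) (x : M) (k i j : Fin 7) (y : R7) : ℝ :=
  1 / 2 * ∑ l, (metricMatrix g x y)⁻¹ k l *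
    (partialDeriv i (fun z => metricMatrix g x z j l) y
      + partialDeriv j (fun z => metricMatrix g x z i l) y
      - partialDeriv l (fun z => metricMatrix g x z i j) y)

/-- The components of the Riemann curvature tensor in the chart at `x`, i.e.
`R(∂_i, ∂_j) ∂_k = ∑_l R^l_{ijk} ∂_l` with
`R^l_{ijk} = ∂_i Γ^l_{jk} - ∂_j Γ^l_{ik} + ∑_m (Γ^l_{im} Γ^m_{jk} - Γ^l_{jm} Γ^m_{ik})`. -/
def riemannCurvature (g : TangentProduct M) (x : M) (l i j k : Fin 7) (y : R7) : ℝ :=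
  partialDeriv i (christoffel g x l j k) y - partialDeriv j (christoffel g x l i k) y
    + ∑ m, (christoffel g x l i m y * christoffel g x m j k y
      - christoffel g x l j m y * christoffel g x m i k y)

/-- A metric is flat if its Riemann curvature tensor vanishes identically. -/
def IsFlat (g : TangentProduct M) : Prop :=
  ∀ x : M, ∀ y ∈ (extChartAt (𝓡 7) x).target, ∀ l i j k : Fin 7,
    riemannCurvature g x l i j k y = 0

/-- A metric is locally isometric to Euclidean `ℝ⁷` if every point has an open neighbourhood
with a diffeomorphism onto an open subset of `ℝ⁷` (that is, a smooth chart) under which the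
Euclidean inner product pulls back to the metric. -/
def IsLocallyIsometricToR7 (g : TangentProduct M) : Prop :=
  ∀ p : M, ∃ e ∈ IsManifold.maximalAtlas (𝓡 7) ∞ M, p ∈ e.source ∧
    ∀ q ∈ e.source, ∀ X Y : TangentSpace (𝓡 7) q,
      g q X Y = inner (E := R7) ℝ (mfderiv (𝓡 7) 𝓘(ℝ, R7) e q X) (mfderiv (𝓡 7) 𝓘(ℝ, R7) e q Y)

end Forms

/-! ### `G₂`-structures -/

/-- A `G₂`-structure on a `7`-manifold: a smooth `3`-form that at each point is linearly
equivalent to `phi0`. -/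
structure G2Structure (M : Type*) [TopologicalSpace M] [ChartedSpace R7 M] where
  form : DiffForm M 3
  smooth : form.IsSmooth
  adapted : ∀ p : M, ∃ L : TangentSpace (𝓡 7) p ≃L[ℝ] R7,
    form p = phi0.compContinuousLinearMap (L : TangentSpace (𝓡 7) p →L[ℝ] R7)

namespace G2Structure

variable {M : Type*} [TopologicalSpace M] [ChartedSpace R7 M] (G : G2Structure M)

/-- An adapted coframe at `p`, identifying the `3`-form at `p` with `phi0`. Two such coframes
differ by an element of the stabiliser of `phi0`, the group `G₂ ⊂ SO(7)`, so that the metric and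
the `4`-form below do not depend on the choice. -/
def frame (p : M) : TangentSpace (𝓡 7) p ≃L[ℝ] R7 := (G.adapted p).choose

/-- The Riemannian metric determined by the `G₂`-structure. -/
def metric : TangentProduct M := fun p X Y => inner ℝ (G.frame p X) (G.frame p Y)

/-- The Hodge dual `4`-form `*φ` determined by the `G₂`-structure. -/
def starForm : DiffForm M 4 := fun p =>
  starPhi0.compContinuousLinearMap (G.frame p : TangentSpace (𝓡 7) p →L[ℝ] R7)

/-- A `G₂`-structure is torsion-free if `φ` is closed and co-closed. -/
def IsTorsionFree : Prop := G.form.IsClosed ∧ G.starForm.IsClosed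

end G2Structure

/-! ### Torus actions and multi-moment maps -/

/-- The three-torus. -/
abbrev Torus3 : Type := Circle × Circle × Circle

/-- The exponential map of `T³`, whose Lie algebra is identified with `ℝ³`. -/
def torusExp (t : Fin 3 → ℝ) : Torus3 :=
  (Circle.exp (t 0), Circle.exp (t 1), Circle.exp (t 2))

section Action

variable {M : Type*} [TopologicalSpace M] [ChartedSpace R7 M] [MulAction Torus3 M]

/-- The infinitesimal action `ξ_p : ℝ³ → T_pM`, `ξ_p(v) = d/ds|₀ exp(sv)·p`, as the differential
of `t ↦ exp(t)·p` at `t = 0`. -/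
def infAction (p : M) : (Fin 3 → ℝ) →L[ℝ] TangentSpace (𝓡 7) p :=
  mfderiv 𝓘(ℝ, Fin 3 → ℝ) (𝓡 7) (fun t : Fin 3 → ℝ => torusExp t • p) 0

/-- The torus action preserves the form `α`. -/
def DiffForm.IsInvariant {k : ℕ} (α : DiffForm M k) : Prop :=
  ∀ (t : Torus3) (p : M),
    (α (t • p)).compContinuousLinearMap (mfderiv (𝓡 7) (𝓡 7) (fun q : M => t • q) p) = α p

/-- `ν : M → Λ^k(𝔱³)*` is a multi-moment map for the `(k+1)`-form `α`: a smooth invariant map with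
`d⟨ν, v_1 ∧ ⋯ ∧ v_k⟩ = α(ξ(v_1), …, ξ(v_k), ·)`. -/
structure IsMultiMomentMap {k : ℕ} (α : DiffForm M (k + 1))
    (ν : M → (Fin 3 → ℝ) [⋀^Fin k]→L[ℝ] ℝ) : Prop where
  smooth : ContMDiff (𝓡 7) 𝓘(ℝ, (Fin 3 → ℝ) [⋀^Fin k]→L[ℝ] ℝ) ∞ ν
  invariant : ∀ (t : Torus3) (p : M), ν (t • p) = ν p
  differential : ∀ (v : Fin k → Fin 3 → ℝ) (p : M) (X : TangentSpace (𝓡 7) p),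
    mfderiv (𝓡 7) 𝓘(ℝ, ℝ) (fun q => ν q v) p X =
      α p (Fin.snoc (α := fun _ => TangentSpace (𝓡 7) p) (fun i => infAction p (v i)) X)

/-- The action is multi-Hamiltonian for `α`. -/
def IsMultiHamiltonian {k : ℕ} (α : DiffForm M (k + 1)) : Prop :=
  ∃ ν : M → (Fin 3 → ℝ) [⋀^Fin k]→L[ℝ] ℝ, IsMultiMomentMap α ν

/-- The set `M₀` of points at which the infinitesimal action is injective. -/
def regularSet (M : Type*) [TopologicalSpace M] [ChartedSpace R7 M] [MulAction Torus3 M] : Set M :=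
  {p | Function.Injective (infAction p)}

namespace G2Structure

variable (G : G2Structure M)

/-- A toric `G₂`-manifold: a torsion-free `G₂`-structure with a smooth effective action of `T³`
that preserves it and is multi-Hamiltonian for both `φ` and `*φ`. -/
structure IsToric : Prop where
  torsionFree : G.IsTorsionFree
  smooth_action : ContMDiffSMul ((𝓡 1).prod ((𝓡 1).prod (𝓡 1))) (𝓡 7) ∞ Torus3 M
  effective : FaithfulSMul Torus3 M
  invariant : G.form.IsInvariant
  multiHamiltonian_form : IsMultiHamiltonian G.form
  multiHamiltonian_starForm : IsMultiHamiltonian G.starForm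

/-- The matrix `B_{ij} = g(U_i, U_j)` of inner products of the generators `U_i = ξ(e_i)`. -/
def B (p : M) : Matrix (Fin 3) (Fin 3) ℝ :=
  Matrix.of fun i j => G.metric p (infAction p (Pi.single i 1)) (infAction p (Pi.single j 1))

/-- The matrix `V = B⁻¹`; meaningful on `M₀`. -/
def V (p : M) : Matrix (Fin 3) (Fin 3) ℝ := (G.B p)⁻¹

end G2Structure

end Action

end

/-! A constant `V` produces an orthonormal coframe that is closed, and a metric with a closed
orthonormal coframe is flat.

Constancy on `M₀` first spreads to `M` (`regularSet_eq_univ`): `M₀` is open since it is given by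
`det B ≠ 0`, closed since it is given by `B C = 1`, and nonempty since the action is effective. So
`B` is constant, and one basis `w` of the Lie algebra has generators that are orthonormal at every
point. Invariance of the moment map of `φ` makes `φ` vanish on the three generators. They form a
basic triple, which completes canonically to a frame adapted to `φ` (`basicMap`, `adaptedMap`).

In the dual coframe (`coframe`), components 0 to 3 are differentials of the moment maps `ν` and `μ`,
hence closed. Components 4 to 6 are the metric duals `θ` of the generators; they are invariant and
constant on the generators, so by Cartan's formula `dθ` is annihilated by the generators
(`fderiv_apply_generator_comm`). Contracting `d*φ = 0` with two generators gives `dθ ∧ dμ = 0`, and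
contracting `dφ = 0` with one generator gives linear relations for what remains; together they force
`dθ = 0` (`torsion_system`, `torsion_eq_zero`).

For a closed coframe `R` the Christoffel symbols are `R⁻¹ ∂R`, whose curvature vanishes
(`riemannCurvature_of_closed_coframe`), and the Poincaré lemma integrates `R` to isometric
coordinates.

Two supporting arguments are needed. The adapted frames are chosen pointwise, so smoothness of the
metric comes from an explicit formula for it in terms of `φ` (`gramOf_comp`), which also shows that
the stabiliser of `phi0` preserves the inner product. And if `M₀` were empty, every point would be
fixed by one of seven involutions of the torus; by Baire one of them would fix an open set, hence
all of `M`, against effectiveness (`regularSet_nonempty`). -/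

noncomputable section

/-! ### The `G₂` cross product and its identities -/

theorem basisForm_three (I : Fin 3 → Fin 7) (X Y Z : R7) :
    basisForm I ![X, Y, Z] =
      X (I 0) * Y (I 1) * Z (I 2) - X (I 0) * Y (I 2) * Z (I 1) - X (I 1) * Y (I 0) * Z (I 2)
        + X (I 1) * Y (I 2) * Z (I 0) + X (I 2) * Y (I 0) * Z (I 1)
        - X (I 2) * Y (I 1) * Z (I 0) := by
  rw [basisForm_apply, Matrix.det_fin_three]
  rfl

/-- The `G₂` cross product on `ℝ⁷`, dual to `phi0`. -/
def cross (X Y : R7) : R7 :=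
  !₂[X 1 * Y 2 - X 2 * Y 1 - (X 3 * Y 4 - X 4 * Y 3) - (X 5 * Y 6 - X 6 * Y 5),
    X 2 * Y 0 - X 0 * Y 2 - (X 3 * Y 5 - X 5 * Y 3) - (X 6 * Y 4 - X 4 * Y 6),
    X 0 * Y 1 - X 1 * Y 0 - (X 3 * Y 6 - X 6 * Y 3) - (X 4 * Y 5 - X 5 * Y 4),
    X 0 * Y 4 - X 4 * Y 0 + (X 1 * Y 5 - X 5 * Y 1) + (X 2 * Y 6 - X 6 * Y 2),
    X 3 * Y 0 - X 0 * Y 3 - (X 1 * Y 6 - X 6 * Y 1) + (X 2 * Y 5 - X 5 * Y 2),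
    X 0 * Y 6 - X 6 * Y 0 + (X 3 * Y 1 - X 1 * Y 3) - (X 2 * Y 4 - X 4 * Y 2),
    X 5 * Y 0 - X 0 * Y 5 + (X 1 * Y 4 - X 4 * Y 1) + (X 3 * Y 2 - X 2 * Y 3)]

theorem inner_R7 (X Y : R7) : inner ℝ X Y =
    X 0 * Y 0 + X 1 * Y 1 + X 2 * Y 2 + X 3 * Y 3 + X 4 * Y 4 + X 5 * Y 5 + X 6 * Y 6 := by
  rw [PiLp.inner_apply]
  simp [Fin.sum_univ_succ, mul_comm]
  ring

theorem phi0_eq_inner (X Y Z : R7) : phi0 ![X, Y, Z] = inner ℝ (cross X Y) Z := by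
  rw [inner_R7]
  simp only [phi0, ContinuousAlternatingMap.sub_apply, ContinuousAlternatingMap.add_apply,
    basisForm_three, cross]
  simp
  ring

theorem ext_R7 {X Y : R7} (h0 : X 0 = Y 0) (h1 : X 1 = Y 1) (h2 : X 2 = Y 2) (h3 : X 3 = Y 3)
    (h4 : X 4 = Y 4) (h5 : X 5 = Y 5) (h6 : X 6 = Y 6) : X = Y := by
  ext i
  fin_cases i <;> assumption

theorem cross_cross_self (X Y : R7) :
    cross X (cross X Y) = (inner ℝ X Y : ℝ) • X - (inner ℝ X X : ℝ) • Y := by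
  simp only [inner_R7]
  apply ext_R7 <;> simp [cross] <;> ring

theorem cross_swap (X Y : R7) : cross Y X = - cross X Y := by
  apply ext_R7 <;> simp [cross] <;> ring

theorem basisForm_four (I : Fin 4 → Fin 7) (X Y Z W : R7) :
    basisForm I ![X, Y, Z, W] =
      X (I 0) * basisForm ![I 1, I 2, I 3] ![Y, Z, W] - X (I 1) * basisForm ![I 0, I 2, I 3] ![Y, Z, W]
      + X (I 2) * basisForm ![I 0, I 1, I 3] ![Y, Z, W]
      - X (I 3) * basisForm ![I 0, I 1, I 2] ![Y, Z, W] := by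
  simp only [basisForm_three]
  rw [basisForm_apply, Matrix.det_succ_row_zero]
  simp [Fin.sum_univ_succ, Matrix.det_fin_three, Fin.succAbove]
  ring

theorem starPhi0_eq_inner (X Y Z W : R7) : starPhi0 ![X, Y, Z, W] =
    inner ℝ (cross X Y) (cross Z W) - inner ℝ X Z * inner ℝ Y W + inner ℝ X W * inner ℝ Y Z := by
  simp only [inner_R7]
  simp only [starPhi0, ContinuousAlternatingMap.sub_apply, ContinuousAlternatingMap.add_apply,
    basisForm_four, basisForm_three, cross]
  simp
  ring

/-- The cross product as a bilinear map. -/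
def crossₗ : R7 →ₗ[ℝ] R7 →ₗ[ℝ] R7 :=
  LinearMap.mk₂ ℝ cross
    (by intro X Y Z; apply ext_R7 <;> simp [cross] <;> ring)
    (by intro c X Y; apply ext_R7 <;> simp [cross] <;> ring)
    (by intro X Y Z; apply ext_R7 <;> simp [cross] <;> ring)
    (by intro c X Y; apply ext_R7 <;> simp [cross] <;> ring)

theorem crossₗ_apply (X Y : R7) : crossₗ X Y = cross X Y := rfl

/-- Polarisation of `cross_cross_self` at `a + b`: orthogonality removes every inner product except
`|a|²` and `|b|²`, which cancel against the unpolarised identities. -/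
theorem cross_cross_of_inner_eq_zero {a b c : R7} (h1 : inner ℝ a b = 0) (h2 : inner ℝ a c = 0)
    (h3 : inner ℝ b c = 0) : cross a (cross b c) = - cross b (cross a c) := by
  have h : cross (a + b) (cross (a + b) c) = 0 - (inner ℝ (a + b) (a + b) : ℝ) • c := by
    rw [cross_cross_self, inner_add_left, h2, h3]; simp
  have e : cross (a + b) (cross (a + b) c) =
      cross a (cross a c) + cross b (cross b c) + (cross a (cross b c) + cross b (cross a c)) := by
    simp only [← crossₗ_apply, map_add, LinearMap.add_apply]
    abel
  have hba : inner ℝ b a = 0 := by rw [real_inner_comm, h1]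
  rw [e, cross_cross_self, cross_cross_self, h2, h3, inner_add_add_self, h1, hba] at h
  have : cross a (cross b c) + cross b (cross a c) = 0 := by
    linear_combination (norm := module) h
  exact eq_neg_of_add_eq_zero_left this

theorem inner_cross_left (X Y : R7) : inner ℝ (cross X Y) X = 0 := by
  rw [inner_R7]; simp [cross]; ring

theorem inner_cross_right (X Y : R7) : inner ℝ (cross X Y) Y = 0 := by
  rw [inner_R7]; simp [cross]; ring

theorem inner_cross_rotate (X Y Z : R7) : inner ℝ (cross X Y) Z = inner ℝ (cross Y Z) X := by
  simp only [inner_R7]; simp [cross]; ring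

theorem inner_cross_cross (X Y Z : R7) :
    inner ℝ (cross X Y) (cross X Z) = inner ℝ X X * inner ℝ Y Z - inner ℝ X Y * inner ℝ X Z := by
  simp only [inner_R7]; simp [cross]; ring

/-! ### Basic triples and the frames they generate -/

/-- A basic triple of the cross product: an orthonormal triple on which `phi0` vanishes. -/
structure IsBasicTriple (a b c : R7) : Prop where
  aa : inner ℝ a a = 1
  bb : inner ℝ b b = 1
  cc : inner ℝ c c = 1
  ab : inner ℝ a b = 0
  bc : inner ℝ b c = 0
  ca : inner ℝ c a = 0
  abc : inner ℝ (cross a b) c = 0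

namespace IsBasicTriple

variable {a b c : R7}

theorem rotate (h : IsBasicTriple a b c) : IsBasicTriple b c a :=
  ⟨h.bb, h.cc, h.aa, h.bc, h.ca, h.ab, by rw [← inner_cross_rotate, h.abc]⟩

theorem cross_left (h : IsBasicTriple a b c) : cross a (cross a b) = -b := by
  rw [cross_cross_self, h.ab, h.aa]; simp

theorem cross_right (h : IsBasicTriple a b c) : cross b (cross a b) = a := by
  rw [cross_swap b a, ← crossₗ_apply, map_neg, crossₗ_apply, cross_cross_self, h.bb,
    real_inner_comm, h.ab]; simp

/-- Cyclic symmetry of the one frame vector that is a triple product. It lets the identities for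
`(a, b, c)` be reused for the rotated triples. -/
theorem cross_third (h : IsBasicTriple a b c) : cross b (cross c a) = cross a (cross b c) := by
  rw [cross_cross_of_inner_eq_zero (a := a) h.ab (by rw [real_inner_comm, h.ca]) h.bc,
    cross_swap c a, ← crossₗ_apply b (-_), map_neg, neg_neg, crossₗ_apply]

theorem cross_assoc (h : IsBasicTriple a b c) : cross a (cross a (cross b c)) = -cross b c := by
  rw [cross_cross_self, h.aa, ← real_inner_comm, ← inner_cross_rotate, h.abc]; simp

theorem cross_pair (h : IsBasicTriple a b c) :
    cross (cross a b) (cross b c) = - cross c a := by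
  have e : cross (cross b c) (cross a b) = - cross a (cross (cross b c) b) := by
    apply cross_cross_of_inner_eq_zero
    · rw [← inner_cross_rotate, h.abc]
    · exact inner_cross_left _ _
    · exact h.ab
  rw [cross_swap, e, cross_swap b (cross b c), h.rotate.cross_left, cross_swap a c]
  simp only [← crossₗ_apply, neg_neg]

theorem inner_cross_pair (h : IsBasicTriple a b c) : inner ℝ (cross a b) (cross b c) = 0 := by
  rw [cross_swap b a, inner_neg_left, inner_cross_cross, h.bc, real_inner_comm c a, h.ca]; simp

theorem cross_assoc_pair (h : IsBasicTriple a b c) :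
    cross (cross a b) (cross a (cross b c)) = c := by
  rw [cross_cross_of_inner_eq_zero (inner_cross_left _ _), h.cross_pair]
  · rw [← crossₗ_apply, map_neg, neg_neg, crossₗ_apply, h.rotate.rotate.cross_right]
  · exact h.inner_cross_pair
  · rw [real_inner_comm, h.rotate.abc]

end IsBasicTriple

/-- The linear map of `ℝ⁷` that takes `e⁵, e⁶, e⁷` to a basic triple and preserves `phi0`. -/
def basicMap (a b c : R7) : R7 →ₗ[ℝ] R7 where
  toFun x := x 0 • (-cross b c) + x 1 • (-cross c a) + x 2 • (-cross a b)
    + x 3 • cross a (cross b c) + x 4 • a + x 5 • b + x 6 • c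
  map_add' x y := by simp only [PiLp.add_apply]; module
  map_smul' r x := by simp only [PiLp.smul_apply, smul_eq_mul, RingHom.id_apply]; module

theorem basicMap_apply (a b c x : R7) : basicMap a b c x =
    x 0 • (-cross b c) + x 1 • (-cross c a) + x 2 • (-cross a b)
    + x 3 • cross a (cross b c) + x 4 • a + x 5 • b + x 6 • c := rfl

theorem cross_same (X : R7) : cross X X = 0 := by
  apply ext_R7 <;> simp [cross] <;> ring

/-- By bilinearity only the multiplication table of the seven frame vectors matters. Its entries are
the identities above for the three rotations of the triple, with `sw` supplying the reversed
products. -/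
theorem IsBasicTriple.cross_basicMap {a b c : R7} (h : IsBasicTriple a b c) (x y : R7) :
    cross (basicMap a b c x) (basicMap a b c y) = basicMap a b c (cross x y) := by
  have sw : ∀ {u v w : R7}, cross u v = w → cross v u = -w := fun h => by rw [cross_swap, h]
  have t1 := h.cross_left
  have t2 := h.rotate.cross_left
  have t3 := h.rotate.rotate.cross_left
  have t4 := h.cross_right
  have t5 := h.rotate.cross_right
  have t6 := h.rotate.rotate.cross_right
  have m1 := h.cross_third
  have m2 := h.rotate.rotate.cross_third.symm
  have n1 := h.cross_assoc
  have n2 := h.rotate.cross_assoc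
  have n3 := h.rotate.rotate.cross_assoc
  have p1 := h.cross_pair
  have p2 := h.rotate.cross_pair
  have p3 := h.rotate.rotate.cross_pair
  have q1 := h.cross_assoc_pair
  have q2 := h.rotate.cross_assoc_pair
  have q3 := h.rotate.rotate.cross_assoc_pair
  rw [m1] at n2 q2
  rw [m2] at n3 q3
  have s1 := sw (rfl : cross a b = _)
  have s2 := sw (rfl : cross b c = _)
  have s3 := sw (rfl : cross c a = _)
  simp only [basicMap_apply, ← crossₗ_apply, map_add, map_smul, map_neg, LinearMap.add_apply,
    LinearMap.smul_apply, LinearMap.neg_apply]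
  simp only [crossₗ_apply, cross_same, t1, t2, t3, t4, t5, t6, m1, m2, n1, n2, n3, p1, p2, p3, q1,
    q2, q3, s1, s2, s3, sw t1, sw t2, sw t3, sw t4, sw t5, sw t6, sw m1, sw m2,
    sw (rfl : cross a (cross b c) = _), sw n1, sw n2, sw n3, sw p1, sw p2, sw p3, sw q1, sw q2, sw q3]
  simp [cross]
  module

theorem IsBasicTriple.inner_basicMap {a b c : R7} (h : IsBasicTriple a b c) (x y : R7) :
    inner ℝ (basicMap a b c x) (basicMap a b c y) = inner ℝ x y := by
  have sw : ∀ {u v : R7} {w : ℝ}, inner ℝ u v = w → inner ℝ v u = w :=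
    fun h => by rw [real_inner_comm, h]
  have m1 := h.cross_third
  have m2 := h.rotate.rotate.cross_third.symm
  have nn : ∀ {u v w : R7}, IsBasicTriple u v w → inner ℝ (cross u v) (cross u v) = 1 :=
    fun h => by rw [inner_cross_cross, h.aa, h.bb, h.ab]; simp
  have q1 := h.inner_cross_pair
  have q2 := h.rotate.inner_cross_pair
  have q3 := h.rotate.rotate.inner_cross_pair
  have l1 := inner_cross_left a b
  have l2 := inner_cross_left b c
  have l3 := inner_cross_left c a
  have r1 := inner_cross_right a b
  have r2 := inner_cross_right b c
  have r3 := inner_cross_right c a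
  have a1 := h.abc
  have a2 := h.rotate.abc
  have a3 := h.rotate.rotate.abc
  have ma := inner_cross_left a (cross b c)
  have mq := inner_cross_right a (cross b c)
  have mb := inner_cross_left b (cross c a)
  have mr := inner_cross_right b (cross c a)
  have mc := inner_cross_left c (cross a b)
  have mp := inner_cross_right c (cross a b)
  have mm : inner ℝ (cross a (cross b c)) (cross a (cross b c)) = 1 := by
    rw [inner_cross_cross, h.aa, nn h.rotate, sw a2]; simp
  rw [m1] at mb mr
  rw [m2] at mc mp
  simp only [basicMap_apply, inner_add_left, inner_add_right, inner_smul_left, inner_smul_right,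
    inner_neg_left, inner_neg_right, nn h, nn h.rotate, nn h.rotate.rotate, q1, q2, q3, sw q1,
    sw q2, sw q3, l1, l2, l3, sw l1, sw l2, sw l3, r1, r2, r3, sw r1, sw r2, sw r3, a1, a2, a3,
    sw a1, sw a2, sw a3, ma, mb, mc, sw ma, sw mb, sw mc, mq, mr, mp, sw mq, sw mr, sw mp, mm,
    h.aa, h.bb, h.cc, h.ab, h.bc, h.ca, sw h.ab, sw h.bc, sw h.ca, inner_R7 x y]
  simp
  ring

/-- The linear isometry of `ℝ⁷` inverse to `basicMap`; its components are explicit. -/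
def adaptedMap (a b c : R7) : R7 →ₗ[ℝ] R7 where
  toFun x := !₂[-inner ℝ (cross b c) x, -inner ℝ (cross c a) x, -inner ℝ (cross a b) x,
    inner ℝ (cross a (cross b c)) x, inner ℝ a x, inner ℝ b x, inner ℝ c x]
  map_add' x y := by
    apply ext_R7 <;> simp [inner_add_right] <;> ring
  map_smul' r x := by
    apply ext_R7 <;> simp [inner_smul_right]

/-- The two maps are transposes of each other for any `a`, `b`, `c`. For a basic triple `basicMap`
is orthogonal, so the transpose becomes the inverse. -/
theorem IsBasicTriple.inner_adaptedMap_eq {a b c : R7} (x y : R7) :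
    inner ℝ (adaptedMap a b c x) y = inner ℝ x (basicMap a b c y) := by
  rw [inner_R7, basicMap_apply, adaptedMap]
  simp only [inner_add_right, inner_smul_right, inner_neg_right]
  simp [real_inner_comm]
  ring

theorem IsBasicTriple.basicMap_adaptedMap {a b c : R7} (h : IsBasicTriple a b c) (x : R7) :
    basicMap a b c (adaptedMap a b c x) = x := by
  have hinj : Function.Injective (basicMap a b c) := by
    rw [← LinearMap.ker_eq_bot, LinearMap.ker_eq_bot']
    intro x hx
    have := h.inner_basicMap x x
    rw [hx, inner_zero_left] at this
    exact inner_self_eq_zero.1 this.symm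
  obtain ⟨y, rfl⟩ := LinearMap.surjective_of_injective hinj x
  congr 1
  refine ext_inner_right ℝ fun z => ?_
  rw [IsBasicTriple.inner_adaptedMap_eq, h.inner_basicMap]

theorem IsBasicTriple.inner_adaptedMap {a b c : R7} (h : IsBasicTriple a b c) (x y : R7) :
    inner ℝ (adaptedMap a b c x) (adaptedMap a b c y) = inner ℝ x y := by
  rw [← h.inner_basicMap, h.basicMap_adaptedMap, h.basicMap_adaptedMap]

theorem IsBasicTriple.phi0_adaptedMap {a b c : R7} (h : IsBasicTriple a b c) (x y z : R7) :
    phi0 ![adaptedMap a b c x, adaptedMap a b c y, adaptedMap a b c z] = phi0 ![x, y, z] := by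
  rw [phi0_eq_inner, phi0_eq_inner, ← h.inner_basicMap, ← h.cross_basicMap, h.basicMap_adaptedMap,
    h.basicMap_adaptedMap, h.basicMap_adaptedMap]

theorem IsBasicTriple.starPhi0_adaptedMap {a b c : R7} (h : IsBasicTriple a b c) (x y z w : R7) :
    starPhi0 ![adaptedMap a b c x, adaptedMap a b c y, adaptedMap a b c z, adaptedMap a b c w] =
      starPhi0 ![x, y, z, w] := by
  simp only [starPhi0_eq_inner, h.inner_adaptedMap]
  rw [← h.inner_basicMap, ← h.cross_basicMap, ← h.cross_basicMap, h.basicMap_adaptedMap,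
    h.basicMap_adaptedMap, h.basicMap_adaptedMap, h.basicMap_adaptedMap]

/-- Up to sign this is component 3 of `adaptedMap`, which is thereby a contraction of `*φ` with the
generators and so a differential of `μ`. -/
theorem IsBasicTriple.starPhi0_apply {a b c : R7} (h : IsBasicTriple a b c) (x : R7) :
    starPhi0 ![a, b, c, x] = -inner ℝ (cross a (cross b c)) x := by
  rw [starPhi0_eq_inner, h.bc, real_inner_comm c a, h.ca, real_inner_comm (cross c x) (cross a b),
    inner_cross_rotate, inner_cross_rotate, cross_swap c, inner_neg_left,
    ← h.rotate.rotate.cross_third]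
  simp

/-! ### The metric as a function of the three-form -/

/-- The matrix of the two-form obtained by contracting a three-form with a vector. -/
def contractMatrix (f : R7 [⋀^Fin 3]→L[ℝ] ℝ) (X : R7) : Matrix (Fin 7) (Fin 7) ℝ :=
  Matrix.of fun i j => f ![X, EuclideanSpace.single i 1, EuclideanSpace.single j 1]

theorem contractMatrix_phi0_mulVec (Y Z : R7) :
    (contractMatrix phi0 Y).mulVec Z.ofLp = -(cross Y Z).ofLp := by
  ext i
  simp only [Matrix.mulVec, dotProduct, contractMatrix, phi0_eq_inner, Matrix.of_apply, inner_R7]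
  fin_cases i <;> simp [Fin.sum_univ_succ, cross] <;> ring

theorem contractMatrix_phi0_transpose (Y : R7) :
    (contractMatrix phi0 Y).transpose = -contractMatrix phi0 Y := by
  ext i j
  simp only [Matrix.transpose_apply, Matrix.neg_apply, contractMatrix, Matrix.of_apply,
    phi0_eq_inner]
  rw [inner_cross_rotate, cross_swap, inner_neg_left, inner_cross_rotate Y, cross_swap]

theorem contractMatrix_phi0_mul_self (Y : R7) :
    contractMatrix phi0 Y * contractMatrix phi0 Y =
      Matrix.vecMulVec Y.ofLp Y.ofLp - (inner ℝ Y Y : ℝ) • 1 := by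
  apply Matrix.ext_of_mulVec_single
  intro i
  rw [← Matrix.mulVec_mulVec]
  have e := contractMatrix_phi0_mulVec Y (EuclideanSpace.single i 1)
  rw [PiLp.ofLp_single] at e
  rw [e, Matrix.mulVec_neg, contractMatrix_phi0_mulVec, cross_cross_self]
  ext j
  simp [Matrix.vecMulVec_apply, Matrix.one_apply, Pi.single_apply, mul_comm,
    EuclideanSpace.inner_single_right]

/-- Let `S` be the skew matrix of the contraction and `K` the projection to `Y`. Since `S² = K - 1`
and `S K = 0`, the matrix `-S + K` is orthogonal, and multiplying by it turns `S + η ηᵀ` into the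
identity plus a matrix of rank at most two. The determinant then reduces to a `2 × 2` one. The
absolute value hides the sign of `det (-S + K)`. -/
theorem abs_det_contractMatrix_phi0_of_unit {Y : R7} (hY : inner ℝ Y Y = 1) (η : Fin 7 → ℝ) :
    |(contractMatrix phi0 Y + Matrix.vecMulVec η η).det| = (η ⬝ᵥ Y.ofLp) ^ 2 := by
  set S := contractMatrix phi0 Y with hS
  have hYY : Y.ofLp ⬝ᵥ Y.ofLp = 1 := by
    rw [← hY, inner_R7]; simp [dotProduct, Fin.sum_univ_succ]; ring
  have hSY : S.mulVec Y.ofLp = 0 := by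
    rw [hS, contractMatrix_phi0_mulVec, cross_same]; simp
  have hSt : S.transpose = -S := contractMatrix_phi0_transpose Y
  have hYS : Matrix.vecMul Y.ofLp S = 0 := by
    rw [← Matrix.mulVec_transpose, hSt, Matrix.neg_mulVec, hSY, neg_zero]
  have hSS : S * S = Matrix.vecMulVec Y.ofLp Y.ofLp - 1 := by
    rw [hS, contractMatrix_phi0_mul_self, hY, one_smul]
  set K := Matrix.vecMulVec Y.ofLp Y.ofLp with hK
  have hKK : K * K = K := by
    rw [hK, Matrix.vecMulVec_mul_vecMulVec, hYY, one_smul]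
  have hSK : S * K = 0 := by rw [hK, Matrix.mul_vecMulVec, hSY]; simp
  have hKS : K * S = 0 := by rw [hK, Matrix.vecMulVec_mul, hYS]; simp
  have d1 : (-S + K).det ^ 2 = 1 := by
    have : (-S + K).transpose * (-S + K) = 1 := by
      have hKt : K.transpose = K := by rw [hK, Matrix.transpose_vecMulVec]
      rw [Matrix.transpose_add, Matrix.transpose_neg, hSt, hKt, neg_neg, add_mul, mul_add, mul_add,
        mul_neg, mul_neg, hSS, hSK, hKS, hKK]
      abel
    have h := congrArg Matrix.det this
    rw [Matrix.det_mul, Matrix.det_transpose, Matrix.det_one] at h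
    rw [sq, h]
  have d2 : ((S + Matrix.vecMulVec η η) * (-S + K)).det = (η ⬝ᵥ Y.ofLp) ^ 2 := by
    set w : Fin 7 → ℝ := S.mulVec η + (η ⬝ᵥ Y.ofLp) • Y.ofLp with hw
    have e : (S + Matrix.vecMulVec η η) * (-S + K) =
        1 + (Matrix.of ![-Y.ofLp, η]).transpose * Matrix.of ![Y.ofLp, w] := by
      have e1 : Matrix.vecMulVec η η * S = - Matrix.vecMulVec η (S.mulVec η) := by
        rw [Matrix.vecMulVec_mul, ← Matrix.mulVec_transpose, hSt, Matrix.neg_mulVec]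
        ext; simp [Matrix.vecMulVec_apply]
      have e2 : Matrix.vecMulVec η η * K = (η ⬝ᵥ Y.ofLp) • Matrix.vecMulVec η Y.ofLp := by
        rw [hK, Matrix.vecMulVec_mul_vecMulVec, Matrix.vecMulVec_smul]
      rw [add_mul, mul_add, mul_add, mul_neg, mul_neg, hSS, hSK, e1, e2, hw]
      ext i j
      simp [Matrix.mul_apply, Fin.sum_univ_succ, Matrix.vecMulVec_apply, hK]
      ring
    rw [e, Matrix.det_one_add_mul_comm, Matrix.det_fin_two]
    have w1 : w ⬝ᵥ Y.ofLp = η ⬝ᵥ Y.ofLp := by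
      rw [hw, add_dotProduct, smul_dotProduct, hYY, dotProduct_comm, Matrix.dotProduct_mulVec, hYS]
      simp
    have en : ∀ (i j : Fin 2), (Matrix.of ![Y.ofLp, w] * (Matrix.of ![-Y.ofLp, η]).transpose) i j
      = ![Y.ofLp, w] i ⬝ᵥ ![-Y.ofLp, η] j := fun i j => rfl
    rw [Matrix.add_apply, Matrix.add_apply, Matrix.add_apply, Matrix.add_apply, en, en, en, en]
    simp [hYY, w1, dotProduct_comm Y.ofLp η]
    ring
  rw [Matrix.det_mul] at d2
  have d3 : |(-S + K).det| = 1 := by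
    rw [← Real.sqrt_sq_eq_abs, d1, Real.sqrt_one]
  have := congrArg abs d2
  rwa [abs_mul, d3, mul_one, abs_of_nonneg (sq_nonneg (η ⬝ᵥ Y.ofLp))] at this

theorem abs_det_contractMatrix_phi0 (Y : R7) (hY : Y ≠ 0) (η : Fin 7 → ℝ) :
    |(contractMatrix phi0 Y + Matrix.vecMulVec η η).det| =
      (inner ℝ Y Y) ^ 2 * (η ⬝ᵥ Y.ofLp) ^ 2 := by
  have hr : 0 < ‖Y‖ := norm_pos_iff.2 hY
  set r := ‖Y‖ with hrdef
  have hu : inner ℝ (r⁻¹ • Y) (r⁻¹ • Y) = (1 : ℝ) := by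
    rw [real_inner_self_eq_norm_sq, norm_smul, ← hrdef, norm_inv, Real.norm_of_nonneg hr.le,
      inv_mul_cancel₀ hr.ne', one_pow]
  -- The factor `1/√r` makes `η ηᵀ` scale by `1/r`, like the contraction. Of the `r ^ 7` from the
  -- determinant, `r ^ 3` is lost to the pairing of the rescaled `η` and `Y`, leaving `|Y|⁴`.
  have key := abs_det_contractMatrix_phi0_of_unit hu ((√r)⁻¹ • η)
  have e : contractMatrix phi0 Y + Matrix.vecMulVec η η =
      r • (contractMatrix phi0 (r⁻¹ • Y) + Matrix.vecMulVec ((√r)⁻¹ • η) ((√r)⁻¹ • η)) := by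
    have h1 : contractMatrix phi0 Y = r • contractMatrix phi0 (r⁻¹ • Y) := by
      ext i j
      simp only [contractMatrix, phi0_eq_inner, Matrix.smul_apply, Matrix.of_apply, ← crossₗ_apply,
        map_smul, LinearMap.smul_apply, inner_smul_left]
      simp [hr.ne']
    have h2 : (√r)⁻¹ * (√r)⁻¹ = r⁻¹ := by
      rw [← mul_inv, Real.mul_self_sqrt hr.le]
    rw [smul_add, ← h1, Matrix.smul_vecMulVec, Matrix.vecMulVec_smul, smul_smul, smul_smul, mul_assoc, h2,
      mul_inv_cancel₀ hr.ne', one_smul]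
  rw [e, Matrix.det_smul, abs_mul, key, real_inner_self_eq_norm_sq, ← hrdef, abs_of_nonneg (by positivity)]
  have h3 : (√r) ^ 2 = r := Real.sq_sqrt hr.le
  simp only [smul_dotProduct, WithLp.ofLp_smul, dotProduct_smul, smul_eq_mul, Fintype.card_fin, mul_pow, inv_pow, h3]
  field_simp

/-- The matrix of a linear endomorphism of `ℝ⁷` in the standard basis. -/
def stdMatrix (L : R7 →L[ℝ] R7) : Matrix (Fin 7) (Fin 7) ℝ :=
  Matrix.of fun i j => L (EuclideanSpace.single j 1) i

theorem apply_eq_stdMatrix_mulVec (L : R7 →L[ℝ] R7) (X : R7) :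
    (L X).ofLp = (stdMatrix L).mulVec X.ofLp := by
  have hX : X = ∑ j, X j • EuclideanSpace.single j (1 : ℝ) := by
    ext i; simp [Finset.sum_apply, Pi.single_apply]
  ext i
  conv_lhs => rw [hX, map_sum]
  simp [stdMatrix, Matrix.mulVec, dotProduct, mul_comm]

theorem det_stdMatrix_ne_zero (L : R7 ≃L[ℝ] R7) : (stdMatrix (L : R7 →L[ℝ] R7)).det ≠ 0 := by
  have : stdMatrix (L : R7 →L[ℝ] R7) * stdMatrix (L.symm : R7 →L[ℝ] R7) = 1 := by
    apply Matrix.ext_of_mulVec_single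
    intro i
    have e := apply_eq_stdMatrix_mulVec (L.symm : R7 →L[ℝ] R7) (EuclideanSpace.single i 1)
    rw [PiLp.ofLp_single] at e
    rw [← Matrix.mulVec_mulVec, ← e, ← apply_eq_stdMatrix_mulVec]
    ext k
    simp [Matrix.one_apply]
  intro h
  have h' := congrArg Matrix.det this
  rw [Matrix.det_mul, h] at h'
  simp at h'

theorem contractMatrix_comp (L : R7 →L[ℝ] R7) (X : R7) :
    contractMatrix (phi0.compContinuousLinearMap L) X =
      (stdMatrix L).transpose * contractMatrix phi0 (L X) * stdMatrix L := by
  have key : ∀ Y Z W : R7, phi0 ![Y, Z, W] =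
      Z.ofLp ⬝ᵥ (contractMatrix phi0 Y).mulVec W.ofLp := by
    intro Y Z W
    rw [contractMatrix_phi0_mulVec, phi0_eq_inner, ← inner_cross_rotate, cross_swap,
      inner_neg_left, inner_R7]
    simp [dotProduct, Fin.sum_univ_succ]
    ring
  ext i j
  have h1 : contractMatrix (phi0.compContinuousLinearMap L) X i j =
      phi0 ![L X, L (EuclideanSpace.single i 1), L (EuclideanSpace.single j 1)] := by
    simp only [contractMatrix, Matrix.of_apply, ContinuousAlternatingMap.compContinuousLinearMap_apply]
    congr 1
    ext k; fin_cases k <;> rfl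
  rw [h1, key, Matrix.mul_assoc, Matrix.mul_apply]
  simp [dotProduct, Matrix.mulVec, Matrix.mul_apply, stdMatrix]

/-- For the pullback of `phi0` by `L`, this is `|det L| |L X|² |η(X)|`. -/
def normDensity (f : R7 [⋀^Fin 3]→L[ℝ] ℝ) (X : R7) (η : Fin 7 → ℝ) : ℝ :=
  √|(contractMatrix f X + Matrix.vecMulVec η η).det|

theorem abs_det_contractMatrix_comp (L : R7 ≃L[ℝ] R7) {X : R7} (hX : X ≠ 0) (η : Fin 7 → ℝ) :
    |(contractMatrix (phi0.compContinuousLinearMap (L : R7 →L[ℝ] R7)) X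
      + Matrix.vecMulVec η η).det| =
      (|(stdMatrix (L : R7 →L[ℝ] R7)).det| * inner ℝ (L X) (L X) * (η ⬝ᵥ X.ofLp)) ^ 2 := by
  set D := stdMatrix (L : R7 →L[ℝ] R7) with hD
  have hdet : IsUnit D.det := isUnit_iff_ne_zero.2 (det_stdMatrix_ne_zero L)
  set ζ := Matrix.vecMul η D⁻¹ with hζ
  have h1 : Matrix.vecMul ζ D = η := by
    rw [hζ, Matrix.vecMul_vecMul, Matrix.nonsing_inv_mul _ hdet, Matrix.vecMul_one]
  have e : contractMatrix (phi0.compContinuousLinearMap (L : R7 →L[ℝ] R7)) X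
      + Matrix.vecMulVec η η =
      D.transpose * (contractMatrix phi0 (L X) + Matrix.vecMulVec ζ ζ) * D := by
    rw [contractMatrix_comp, mul_add, add_mul, Matrix.mul_vecMulVec, Matrix.vecMulVec_mul,
      Matrix.mulVec_transpose, h1]
    rfl
  have h2 : ζ ⬝ᵥ (L X).ofLp = η ⬝ᵥ X.ofLp := by
    have := apply_eq_stdMatrix_mulVec (L : R7 →L[ℝ] R7) X
    rw [ContinuousLinearEquiv.coe_coe] at this
    rw [this, Matrix.dotProduct_mulVec, h1]
  rw [e, Matrix.det_mul, Matrix.det_mul, Matrix.det_transpose, abs_mul, abs_mul,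
    abs_det_contractMatrix_phi0 _ (by simpa using hX), h2]
  ring

theorem normDensity_comp (L : R7 ≃L[ℝ] R7) {X : R7} (hX : X ≠ 0) {η : Fin 7 → ℝ}
    (hη : η ⬝ᵥ X.ofLp = 1) :
    normDensity (phi0.compContinuousLinearMap (L : R7 →L[ℝ] R7)) X η =
      |(stdMatrix (L : R7 →L[ℝ] R7)).det| * inner ℝ (L X) (L X) := by
  rw [normDensity, abs_det_contractMatrix_comp L hX, hη, mul_one, Real.sqrt_sq]
  exact mul_nonneg (abs_nonneg _) real_inner_self_nonneg

/-- For the pullback of `phi0` by `L`, this is the Gram matrix of `L` multiplied by `|det L|`. -/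
def gramDensity (f : R7 [⋀^Fin 3]→L[ℝ] ℝ) : Matrix (Fin 7) (Fin 7) ℝ :=
  Matrix.of fun i j => if i = j then normDensity f (EuclideanSpace.single i 1) (Pi.single i 1) else
    (normDensity f (EuclideanSpace.single i 1 + EuclideanSpace.single j 1) (Pi.single i 1)
      - normDensity f (EuclideanSpace.single i 1) (Pi.single i 1)
      - normDensity f (EuclideanSpace.single j 1) (Pi.single j 1)) / 2

/-- The Gram matrix of the metric determined by a three-form. -/
def gramOf (f : R7 [⋀^Fin 3]→L[ℝ] ℝ) (i j : Fin 7) : ℝ :=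
  gramDensity f i j / (gramDensity f).det ^ (1 / 9 : ℝ)

theorem single_add_single_ne_zero {i j : Fin 7} (h : i ≠ j) :
    (EuclideanSpace.single i 1 + EuclideanSpace.single j 1 : R7) ≠ 0 := by
  intro h0
  have := congrArg (fun v : R7 => v i) h0
  simp [h] at this

theorem gramDensity_comp (L : R7 ≃L[ℝ] R7) (i j : Fin 7) :
    gramDensity (phi0.compContinuousLinearMap (L : R7 →L[ℝ] R7)) i j =
      |(stdMatrix (L : R7 →L[ℝ] R7)).det| *
        inner ℝ (L (EuclideanSpace.single i 1)) (L (EuclideanSpace.single j 1)) := by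
  have hs : ∀ i : Fin 7, (EuclideanSpace.single i 1 : R7) ≠ 0 := fun i => by simp
  have h1 : ∀ i, normDensity (phi0.compContinuousLinearMap (L : R7 →L[ℝ] R7))
      (EuclideanSpace.single i 1) (Pi.single i 1) = |(stdMatrix (L : R7 →L[ℝ] R7)).det| *
        inner ℝ (L (EuclideanSpace.single i 1)) (L (EuclideanSpace.single i 1)) := fun i =>
    normDensity_comp L (hs i) (by simp)
  rw [gramDensity, Matrix.of_apply]
  split_ifs with h
  · rw [h1, h]
  · rw [normDensity_comp L (single_add_single_ne_zero h) (by simp [h]), h1, h1, map_add,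
      inner_add_add_self, real_inner_comm (L (EuclideanSpace.single i 1)) (L (EuclideanSpace.single j 1))]
    ring

/-- Seven factors `|det L|` come from scaling a `7 × 7` matrix and two from the Gram matrix `Dᵀ D`.
This is the source of the exponent `1 / 9` in `gramOf`. -/
theorem det_gramDensity_comp (L : R7 ≃L[ℝ] R7) :
    (gramDensity (phi0.compContinuousLinearMap (L : R7 →L[ℝ] R7))).det =
      |(stdMatrix (L : R7 →L[ℝ] R7)).det| ^ 9 := by
  set D := stdMatrix (L : R7 →L[ℝ] R7) with hD
  have : gramDensity (phi0.compContinuousLinearMap (L : R7 →L[ℝ] R7)) =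
      |D.det| • (D.transpose * D) := by
    ext i j
    rw [gramDensity_comp, Matrix.smul_apply, Matrix.mul_apply, smul_eq_mul, ← hD, PiLp.inner_apply]
    simp [hD, stdMatrix, mul_comm]
  rw [this, Matrix.det_smul, Matrix.det_mul, Matrix.det_transpose]
  simp
  rw [← sq, ← sq_abs D.det]
  ring

/-- The three-form determines the metric. -/
theorem gramOf_comp (L : R7 ≃L[ℝ] R7) (i j : Fin 7) :
    gramOf (phi0.compContinuousLinearMap (L : R7 →L[ℝ] R7)) i j =
      inner ℝ (L (EuclideanSpace.single i 1)) (L (EuclideanSpace.single j 1)) := by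
  have h := abs_pos.2 (det_stdMatrix_ne_zero L)
  have h9 : (|(stdMatrix (L : R7 →L[ℝ] R7)).det| ^ 9) ^ (1 / 9 : ℝ) =
      |(stdMatrix (L : R7 →L[ℝ] R7)).det| := by
    rw [← Real.rpow_natCast, ← Real.rpow_mul h.le]; norm_num
  rw [gramOf, det_gramDensity_comp, gramDensity_comp, h9, mul_div_cancel_left₀ _ h.ne']

/-! ### Smooth dependence of the metric on the three-form -/

section Smooth

variable {E : Type*} [NormedAddCommGroup E] [NormedSpace ℝ E] {n : ℕ∞} {y : E}

theorem ContDiffAt.continuousAlternatingMap_apply_const {k : ℕ} {f : E → R7 [⋀^Fin k]→L[ℝ] ℝ}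
    (hf : ContDiffAt ℝ n f y) (v : Fin k → R7) : ContDiffAt ℝ n (fun z => f z v) y :=
  ((ContinuousMultilinearMap.apply ℝ (fun _ : Fin k => R7) ℝ v).comp
    (ContinuousAlternatingMap.toContinuousMultilinearMapCLM ℝ)).contDiff.contDiffAt.comp y hf

theorem ContDiffAt.matrix_det {ι : Type*} [Fintype ι] [DecidableEq ι] {A : E → Matrix ι ι ℝ}
    (hA : ∀ i j, ContDiffAt ℝ n (fun z => A z i j) y) : ContDiffAt ℝ n (fun z => (A z).det) y := by
  simp only [Matrix.det_apply]
  refine ContDiffAt.sum fun σ _ => ContDiffAt.const_smul _ ?_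
  exact contDiffAt_prod fun i _ => hA _ _

theorem ContDiffAt.normDensity {f : E → R7 [⋀^Fin 3]→L[ℝ] ℝ} (hf : ContDiffAt ℝ n f y)
    {L : R7 ≃L[ℝ] R7} (hL : f y = phi0.compContinuousLinearMap (L : R7 →L[ℝ] R7)) {X : R7}
    (hX : X ≠ 0) {η : Fin 7 → ℝ} (hη : η ⬝ᵥ X.ofLp = 1) :
    ContDiffAt ℝ n (fun z => normDensity (f z) X η) y := by
  -- The absolute value and the square root are smooth only away from zero; the condition that `η`
  -- takes the value 1 on `X` keeps the determinant nonzero.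
  have h1 : |(contractMatrix (f y) X + Matrix.vecMulVec η η).det| ≠ 0 := by
    rw [hL, abs_det_contractMatrix_comp L hX, hη]
    have := det_stdMatrix_ne_zero L
    have : L X ≠ 0 := by simpa using hX
    simp only [inner_self_eq_norm_sq_to_K]
    simp_all
  have h2 : ContDiffAt ℝ n (fun z => (contractMatrix (f z) X + Matrix.vecMulVec η η).det) y := by
    refine ContDiffAt.matrix_det fun i j => ?_
    exact (hf.continuousAlternatingMap_apply_const _).add contDiffAt_const
  exact ((contDiffAt_abs (by simpa using h1)).comp y h2).sqrt h1

theorem ContDiffAt.gramDensity {f : E → R7 [⋀^Fin 3]→L[ℝ] ℝ} (hf : ContDiffAt ℝ n f y)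
    {L : R7 ≃L[ℝ] R7} (hL : f y = phi0.compContinuousLinearMap (L : R7 →L[ℝ] R7)) (i j : Fin 7) :
    ContDiffAt ℝ n (fun z => gramDensity (f z) i j) y := by
  have hs : ∀ i : Fin 7, (EuclideanSpace.single i 1 : R7) ≠ 0 := fun i => by simp
  have h1 : ∀ i, ContDiffAt ℝ n (fun z => _root_.normDensity (f z)
      (EuclideanSpace.single i 1) (Pi.single i 1)) y := fun i => hf.normDensity hL (hs i) (by simp)
  simp only [_root_.gramDensity, Matrix.of_apply]
  split_ifs with h
  · exact h1 i
  · exact (((hf.normDensity hL (single_add_single_ne_zero h) (by simp [h])).sub (h1 i)).sub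
      (h1 j)).div_const 2

theorem ContDiffAt.gramOf {f : E → R7 [⋀^Fin 3]→L[ℝ] ℝ} (hf : ContDiffAt ℝ n f y)
    {L : R7 ≃L[ℝ] R7} (hL : f y = phi0.compContinuousLinearMap (L : R7 →L[ℝ] R7)) (i j : Fin 7) :
    ContDiffAt ℝ n (fun z => gramOf (f z) i j) y := by
  have h := abs_pos.2 (det_stdMatrix_ne_zero L)
  have hd : 0 < (_root_.gramDensity (f y)).det := by
    rw [hL, det_gramDensity_comp]; positivity
  refine (hf.gramDensity hL i j).div ?_ (Real.rpow_pos_of_pos hd _).ne'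
  exact (ContDiffAt.matrix_det fun i j => hf.gramDensity hL i j).rpow_const_of_ne hd.ne'

end Smooth

/-! ### Exterior derivatives of constant forms pulled back by a coframe -/

/-- Leibniz rule: `α` is constant, so only the coframe is differentiated, in one slot at a time. -/
theorem extDeriv_comp_const_apply {k : ℕ} (α : R7 [⋀^Fin k]→L[ℝ] ℝ) {R : R7 → R7 →L[ℝ] R7}
    {y : R7} {R' : R7 →L[ℝ] R7 →L[ℝ] R7} (hR : HasFDerivAt R R' y) (x : Fin (k + 1) → R7) :
    extDeriv (fun z => α.compContinuousLinearMap (R z)) y x =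
      ∑ i : Fin (k + 1), (-1) ^ (i : ℕ) * ∑ j : Fin k,
        α (Function.update (fun m => R y (i.removeNth x m)) j (R' (x i) (i.removeNth x j))) := by
  have h := ((hasFDerivAt_const α y).continuousAlternatingMapCompContinuousLinearMap hR).fderiv
  rw [extDeriv, h, ContinuousAlternatingMap.alternatizeUncurryFin_apply]
  refine Finset.sum_congr rfl fun i _ => ?_
  simp only [add_apply, ContinuousLinearMap.comp_apply,
    ContinuousAlternatingMap.add_apply, zsmul_eq_mul, ContinuousAlternatingMap.fderivCompContinuousLinearMap_apply]
  simp
  refine Finset.sum_congr rfl fun j _ => ?_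
  congr 1
  ext m
  by_cases h : m = j
  · subst h; simp
  · simp [h]

theorem extDeriv_phi0_comp {R : R7 → R7 →L[ℝ] R7} {y : R7} {R' : R7 →L[ℝ] R7 →L[ℝ] R7}
    (hR : HasFDerivAt R R' y) (a b c d : R7) :
    extDeriv (fun z => phi0.compContinuousLinearMap (R z)) y ![a, b, c, d] =
      (phi0 ![R' a b, R y c, R y d]
        + phi0 ![R y b, R' a c, R y d]
        + phi0 ![R y b, R y c, R' a d])
      - (phi0 ![R' b a, R y c, R y d]
        + phi0 ![R y a, R' b c, R y d]
        + phi0 ![R y a, R y c, R' b d])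
      + (phi0 ![R' c a, R y b, R y d]
        + phi0 ![R y a, R' c b, R y d]
        + phi0 ![R y a, R y b, R' c d])
      - (phi0 ![R' d a, R y b, R y c]
        + phi0 ![R y a, R' d b, R y c]
        + phi0 ![R y a, R y b, R' d c]) := by
  rw [extDeriv_comp_const_apply phi0 hR]
  obtain ⟨P, hP⟩ : ∃ P : R7 → R7 → R7 → ℝ, ∀ u v w, phi0 ![u, v, w] = P u v w :=
    ⟨_, fun _ _ _ => rfl⟩
  have e : ∀ g : Fin 3 → R7, phi0 g = P (g 0) (g 1) (g 2) := by
    intro g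
    rw [← hP]
    congr 1; ext m; fin_cases m <;> rfl
  simp only [hP, e, Fin.sum_univ_succ (n := 3), Fin.sum_univ_succ]
  simp [Fin.removeNth, Function.update_apply, Fin.succAbove]
  ring

theorem extDeriv_starPhi0_comp {R : R7 → R7 →L[ℝ] R7} {y : R7} {R' : R7 →L[ℝ] R7 →L[ℝ] R7}
    (hR : HasFDerivAt R R' y) (a b c d e : R7) :
    extDeriv (fun z => starPhi0.compContinuousLinearMap (R z)) y ![a, b, c, d, e] =
      (starPhi0 ![R' a b, R y c, R y d, R y e]
        + starPhi0 ![R y b, R' a c, R y d, R y e]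
        + starPhi0 ![R y b, R y c, R' a d, R y e]
        + starPhi0 ![R y b, R y c, R y d, R' a e])
      - (starPhi0 ![R' b a, R y c, R y d, R y e]
        + starPhi0 ![R y a, R' b c, R y d, R y e]
        + starPhi0 ![R y a, R y c, R' b d, R y e]
        + starPhi0 ![R y a, R y c, R y d, R' b e])
      + (starPhi0 ![R' c a, R y b, R y d, R y e]
        + starPhi0 ![R y a, R' c b, R y d, R y e]
        + starPhi0 ![R y a, R y b, R' c d, R y e]
        + starPhi0 ![R y a, R y b, R y d, R' c e])
      - (starPhi0 ![R' d a, R y b, R y c, R y e]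
        + starPhi0 ![R y a, R' d b, R y c, R y e]
        + starPhi0 ![R y a, R y b, R' d c, R y e]
        + starPhi0 ![R y a, R y b, R y c, R' d e])
      + (starPhi0 ![R' e a, R y b, R y c, R y d]
        + starPhi0 ![R y a, R' e b, R y c, R y d]
        + starPhi0 ![R y a, R y b, R' e c, R y d]
        + starPhi0 ![R y a, R y b, R y c, R' e d]) := by
  rw [extDeriv_comp_const_apply starPhi0 hR]
  obtain ⟨P, hP⟩ : ∃ P : R7 → R7 → R7 → R7 → ℝ, ∀ u v w t, starPhi0 ![u, v, w, t] = P u v w t :=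
    ⟨_, fun _ _ _ _ => rfl⟩
  have e : ∀ g : Fin 4 → R7, starPhi0 g = P (g 0) (g 1) (g 2) (g 3) := by
    intro g
    rw [← hP]
    congr 1; ext m; fin_cases m <;> rfl
  simp only [hP, e, Fin.sum_univ_succ (n := 4), Fin.sum_univ_succ]
  simp [Fin.removeNth, Function.update_apply, Fin.succAbove]
  ring

/-! ### Vanishing of the torsion of the coframe -/

theorem phi0_apply (X Y Z : R7) : phi0 ![X, Y, Z] =
    (X 1 * Y 2 - X 2 * Y 1 - (X 3 * Y 4 - X 4 * Y 3) - (X 5 * Y 6 - X 6 * Y 5)) * Z 0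
    + (X 2 * Y 0 - X 0 * Y 2 - (X 3 * Y 5 - X 5 * Y 3) - (X 6 * Y 4 - X 4 * Y 6)) * Z 1
    + (X 0 * Y 1 - X 1 * Y 0 - (X 3 * Y 6 - X 6 * Y 3) - (X 4 * Y 5 - X 5 * Y 4)) * Z 2
    + (X 0 * Y 4 - X 4 * Y 0 + (X 1 * Y 5 - X 5 * Y 1) + (X 2 * Y 6 - X 6 * Y 2)) * Z 3
    + (X 3 * Y 0 - X 0 * Y 3 - (X 1 * Y 6 - X 6 * Y 1) + (X 2 * Y 5 - X 5 * Y 2)) * Z 4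
    + (X 0 * Y 6 - X 6 * Y 0 + (X 3 * Y 1 - X 1 * Y 3) - (X 2 * Y 4 - X 4 * Y 2)) * Z 5
    + (X 5 * Y 0 - X 0 * Y 5 + (X 1 * Y 4 - X 4 * Y 1) + (X 3 * Y 2 - X 2 * Y 3)) * Z 6 := by
  rw [phi0_eq_inner, inner_R7]
  simp [cross]

theorem phi0_swap (u v w : R7) : phi0 ![u, v, w] = -phi0 ![v, u, w] := by
  rw [phi0_eq_inner, phi0_eq_inner, cross_swap, inner_neg_left]

theorem phi0_swap_right (u v w : R7) : phi0 ![u, v, w] = -phi0 ![u, w, v] := by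
  rw [phi0_apply, phi0_apply]
  ring

theorem phi0_rotate (u v w : R7) : phi0 ![u, v, w] = phi0 ![v, w, u] := by
  rw [phi0_eq_inner, phi0_eq_inner, inner_cross_rotate]

theorem phi0_sub (u u' v w : R7) :
    phi0 ![u - u', v, w] = phi0 ![u, v, w] - phi0 ![u', v, w] := by
  simp only [phi0_eq_inner, ← crossₗ_apply, map_sub, LinearMap.sub_apply, inner_sub_left]

theorem starPhi0_swap (u v w t : R7) : starPhi0 ![u, v, w, t] = -starPhi0 ![v, u, w, t] := by
  rw [starPhi0_eq_inner, starPhi0_eq_inner, cross_swap, inner_neg_left]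
  ring

theorem starPhi0_swap_right (u v w t : R7) : starPhi0 ![u, v, w, t] = -starPhi0 ![u, v, t, w] := by
  rw [starPhi0_eq_inner, starPhi0_eq_inner, cross_swap t w, inner_neg_right]
  ring

theorem starPhi0_swap_middle (u v w t : R7) :
    starPhi0 ![u, v, w, t] = -starPhi0 ![u, w, v, t] := by
  simp only [starPhi0_eq_inner, inner_R7]
  simp [cross]
  ring

theorem starPhi0_sub (u u' v w t : R7) :
    starPhi0 ![u - u', v, w, t] = starPhi0 ![u, v, w, t] - starPhi0 ![u', v, w, t] := by
  simp only [starPhi0_eq_inner, ← crossₗ_apply, map_sub, LinearMap.sub_apply, inner_sub_left]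
  ring

section Torsion

variable {τ X : R7} (hτ : ∀ k : Fin 7, k.val < 4 → τ k = 0)
  (hX : ∀ i : Fin 7, 4 ≤ i.val → X i = 0)

include hτ hX

/-- Here `τ` has only components 4 to 6 and `X` only components 0 to 3. The three values of `phi0`
are the coordinates of the ordinary cross product in `ℝ³` of `(X 0, X 1, X 2)` with `(τ 4, τ 5, τ
6)`. -/
theorem phi0_torsion_four : phi0 ![τ, X, EuclideanSpace.single 4 1] = τ 6 * X 1 - τ 5 * X 2 := by
  simp [phi0_apply, hτ 0, hτ 1, hτ 2, hτ 3, hX 4, hX 5, hX 6]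
  ring

theorem phi0_torsion_five : phi0 ![τ, X, EuclideanSpace.single 5 1] = τ 4 * X 2 - τ 6 * X 0 := by
  simp [phi0_apply, hτ 0, hτ 1, hτ 2, hτ 3, hX 4, hX 5, hX 6]
  ring

theorem phi0_torsion_six : phi0 ![τ, X, EuclideanSpace.single 6 1] = τ 5 * X 0 - τ 4 * X 1 := by
  simp [phi0_apply, hτ 0, hτ 1, hτ 2, hτ 3, hX 4, hX 5, hX 6]
  ring

/-- Contracted with two generators, `starPhi0` sees only component 3 of `X`. Closedness of `*φ`
therefore says that each vertical torsion component wedges to zero with `dμ`. -/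
theorem starPhi0_torsion45 : starPhi0 ![τ, X, EuclideanSpace.single 4 1,
    EuclideanSpace.single 5 1] = -(τ 6 * X 3) := by
  simp [starPhi0_eq_inner, inner_R7, cross, hτ 0, hτ 1, hτ 2, hτ 3, hX 4, hX 5, hX 6]

theorem starPhi0_torsion46 : starPhi0 ![τ, X, EuclideanSpace.single 4 1,
    EuclideanSpace.single 6 1] = τ 5 * X 3 := by
  simp [starPhi0_eq_inner, inner_R7, cross, hτ 0, hτ 1, hτ 2, hτ 3, hX 4, hX 5, hX 6]

theorem starPhi0_torsion56 : starPhi0 ![τ, X, EuclideanSpace.single 5 1,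
    EuclideanSpace.single 6 1] = -(τ 4 * X 3) := by
  simp [starPhi0_eq_inner, inner_R7, cross, hτ 0, hτ 1, hτ 2, hτ 3, hX 4, hX 5, hX 6]

end Torsion

/-- The algebraic system satisfied by the torsion of a closed and coclosed coframe. -/
theorem torsion_system {D : Fin 7 → Fin 7 → R7} {e : Fin 7 → R7}
    (he : e = fun i => EuclideanSpace.single i 1)
    (pT : ∀ a b c i : Fin 7, 4 ≤ i.val →
      phi0 ![D a b - D b a, e c, e i] - phi0 ![D a c - D c a, e b, e i]
      + phi0 ![D b c - D c b, e a, e i] = 0)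
    (qT : ∀ a b c i j : Fin 7, 4 ≤ i.val → 4 ≤ j.val →
      starPhi0 ![D a b - D b a, e c, e i, e j] - starPhi0 ![D a c - D c a, e b, e i, e j]
      + starPhi0 ![D b c - D c b, e a, e i, e j] = 0)
    (comp0 : ∀ a b : Fin 7, ∀ k : Fin 7, k.val < 4 → (D a b - D b a) k = 0) :
    (∀ a b : Fin 7, a.val < 3 → b.val < 3 → D a b = D b a) ∧
      D 0 3 - D 3 0 = 0 ∧ D 1 3 - D 3 1 = 0 ∧ D 2 3 - D 3 2 = 0 := by
  have hz : ∀ c : Fin 7, c.val < 4 → ∀ i : Fin 7, 4 ≤ i.val → e c i = 0 := by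
    intro c hc i hi
    simp only [he, PiLp.single_apply]
    apply if_neg
    rintro rfl
    omega
  have he4 : e 4 = EuclideanSpace.single 4 1 := by rw [he]
  have he5 : e 5 = EuclideanSpace.single 5 1 := by rw [he]
  have he6 : e 6 = EuclideanSpace.single 6 1 := by rw [he]
  have tri : ∀ a b : Fin 7, a.val < 3 → b.val < 3 → D a b = D b a ∧ ∀ i : Fin 7, 4 ≤ i.val →
      phi0 ![D a 3 - D 3 a, e b, e i] = phi0 ![D b 3 - D 3 b, e a, e i] := by
    intro a b ha hb
    have ha4 := hz a (by omega)
    have hb4 := hz b (by omega)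
    have ha3 : e a 3 = 0 := by
      simp only [he, PiLp.single_apply]; apply if_neg; rintro rfl; simp at ha
    have hb3 : e b 3 = 0 := by
      simp only [he, PiLp.single_apply]; apply if_neg; rintro rfl; simp at hb
    -- Evaluating the wedge product with the third coframe direction `e 3` isolates the torsion on
    -- `(a, b)`, since `e a` and `e b` have no component 3.
    have h0 : D a b - D b a = 0 := by
      have h := comp0 a b
      have q1 := qT a b 3 4 5 (by decide) (by decide)
      have q2 := qT a b 3 4 6 (by decide) (by decide)
      have q3 := qT a b 3 5 6 (by decide) (by decide)
      rw [he4, he5] at q1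
      rw [he4, he6] at q2
      rw [he5, he6] at q3
      rw [starPhi0_torsion45 (comp0 _ _) (hz 3 (by decide)), starPhi0_torsion45 (comp0 _ _) hb4,
        starPhi0_torsion45 (comp0 _ _) ha4, ha3, hb3] at q1
      rw [starPhi0_torsion46 (comp0 _ _) (hz 3 (by decide)), starPhi0_torsion46 (comp0 _ _) hb4,
        starPhi0_torsion46 (comp0 _ _) ha4, ha3, hb3] at q2
      rw [starPhi0_torsion56 (comp0 _ _) (hz 3 (by decide)), starPhi0_torsion56 (comp0 _ _) hb4,
        starPhi0_torsion56 (comp0 _ _) ha4, ha3, hb3] at q3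
      simp only [he, PiLp.single_apply, if_true, mul_zero, mul_one, neg_zero, sub_zero, add_zero, neg_eq_zero] at q1 q2 q3
      exact ext_R7 (h 0 (by decide)) (h 1 (by decide)) (h 2 (by decide)) (h 3 (by decide)) q3 q2 q1
    refine ⟨sub_eq_zero.1 h0, fun i hi => ?_⟩
    have h := pT a b 3 i hi
    have hz3 : phi0 ![0, e 3, e i] = 0 := by simp [phi0_apply]
    rw [h0, hz3] at h
    linarith
  have eqs : ∀ a b : Fin 7, a.val < 3 → b.val < 3 → ∀ s t : R7, s = D a 3 - D 3 a →
      t = D b 3 - D 3 b → s 6 * e b 1 - s 5 * e b 2 = t 6 * e a 1 - t 5 * e a 2 ∧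
      s 4 * e b 2 - s 6 * e b 0 = t 4 * e a 2 - t 6 * e a 0 ∧
      s 5 * e b 0 - s 4 * e b 1 = t 5 * e a 0 - t 4 * e a 1 := by
    rintro a b ha hb s t rfl rfl
    have h := (tri a b ha hb).2
    rw [← phi0_torsion_four (comp0 a 3) (hz b (by omega)), ← phi0_torsion_four (comp0 b 3) (hz a (by omega)),
      ← phi0_torsion_five (comp0 a 3) (hz b (by omega)), ← phi0_torsion_five (comp0 b 3) (hz a (by omega)),
      ← phi0_torsion_six (comp0 a 3) (hz b (by omega)), ← phi0_torsion_six (comp0 b 3) (hz a (by omega))]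
    rw [← he4, ← he5, ← he6]
    exact ⟨h 4 (by decide), h 5 (by decide), h 6 (by decide)⟩
  refine ⟨fun a b ha hb => (tri a b ha hb).1, ?_⟩
  have k3 : D 0 3 - D 3 0 = 0 ∧ D 1 3 - D 3 1 = 0 ∧ D 2 3 - D 3 2 = 0 := by
    have e01 := eqs 0 1 (by decide) (by decide) _ _ rfl rfl
    have e12 := eqs 1 2 (by decide) (by decide) _ _ rfl rfl
    have e20 := eqs 2 0 (by decide) (by decide) _ _ rfl rfl
    have h0 := comp0 0 3
    have h1 := comp0 1 3
    have h2 := comp0 2 3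
    generalize D 0 3 - D 3 0 = s at *
    generalize D 1 3 - D 3 1 = t at *
    generalize D 2 3 - D 3 2 = u at *
    simp [he] at e01 e12 e20
    -- Nine equations for the nine vertical components of `s`, `t`, `u`: the off-diagonal ones
    -- vanish directly, while `s 4`, `t 5`, `u 6` have pairwise sums zero and so vanish too.
    obtain ⟨a1, a2, a3⟩ := e01
    obtain ⟨b1, b2, b3⟩ := e12
    obtain ⟨c1, c2, c3⟩ := e20
    refine ⟨ext_R7 (h0 0 (by decide)) (h0 1 (by decide)) (h0 2 (by decide)) (h0 3 (by decide))
      ?_ ?_ ?_, ext_R7 (h1 0 (by decide)) (h1 1 (by decide)) (h1 2 (by decide)) (h1 3 (by decide))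
      ?_ ?_ ?_, ext_R7 (h2 0 (by decide)) (h2 1 (by decide)) (h2 2 (by decide)) (h2 3 (by decide))
      ?_ ?_ ?_⟩ <;> rw [PiLp.zero_apply] <;> linarith
  exact k3

/-- The torsion of a closed and coclosed coframe vanishes if four of its components are closed and
its contractions with the remaining three directions vanish. -/
theorem torsion_eq_zero {R : R7 → R7 →L[ℝ] R7} {y : R7} {R' : R7 →L[ℝ] R7 →L[ℝ] R7}
    (hR : HasFDerivAt R R' y) (E : R7 ≃L[ℝ] R7) (hE : R y = E)
    (h1 : ∀ k : Fin 7, k.val < 4 → ∀ a b, R' a b k = R' b a k)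
    (h2 : ∀ i : Fin 7, 4 ≤ i.val → ∀ a, R' (E.symm (EuclideanSpace.single i 1)) a =
      R' a (E.symm (EuclideanSpace.single i 1)))
    (h3 : extDeriv (fun z => phi0.compContinuousLinearMap (R z)) y = 0)
    (h4 : extDeriv (fun z => starPhi0.compContinuousLinearMap (R z)) y = 0) (a b : R7) :
    R' a b = R' b a := by
  set v : Fin 7 → R7 := fun i => E.symm (EuclideanSpace.single i 1) with hv
  set e : Fin 7 → R7 := fun i => EuclideanSpace.single i 1 with he
  have hRv : ∀ i, R y (v i) = e i := fun i => by simp [hE, hv, he]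
  have p : ∀ a b c i : Fin 7, _ := fun a b c i =>
    (extDeriv_phi0_comp hR (v a) (v b) (v c) (v i)).symm.trans
      (by rw [h3]; rfl : _ = (0 : ℝ))
  have q : ∀ a b c i j : Fin 7, _ := fun a b c i j =>
    (extDeriv_starPhi0_comp hR (v a) (v b) (v c) (v i) (v j)).symm.trans
      (by rw [h4]; rfl : _ = (0 : ℝ))
  obtain ⟨D, hD⟩ : ∃ D : Fin 7 → Fin 7 → R7, ∀ i j, R' (v i) (v j) = D i j := ⟨_, fun _ _ => rfl⟩
  simp only [hRv, hD] at p q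
  have dU : ∀ i : Fin 7, 4 ≤ i.val → ∀ j, D i j = D j i := fun i hi j => by
    rw [← hD, ← hD]; exact h2 i hi _
  -- With a vertical last index, `dU` makes the derivatives that involve this index cancel in pairs.
  -- Only the torsion on the other three indices survives; `qT` is the same with two vertical
  -- indices.
  have pT : ∀ a b c i : Fin 7, 4 ≤ i.val →
      phi0 ![D a b - D b a, e c, e i]
      - phi0 ![D a c - D c a, e b, e i]
      + phi0 ![D b c - D c b, e a, e i] = 0 := by
    intro a b c i hi
    have := p a b c i
    rw [dU i hi, dU i hi, dU i hi] at this
    simp only [phi0_sub]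
    linear_combination this - phi0_swap (e b) (D a c) (e i) + phi0_swap (e a) (D b c) (e i)
      - phi0_swap (e a) (D c b) (e i) + phi0_rotate (D a i) (e b) (e c)
      + phi0_swap_right (e a) (e c) (D b i)
  have qT : ∀ a b c i j : Fin 7, 4 ≤ i.val → 4 ≤ j.val →
      starPhi0 ![D a b - D b a, e c, e i,
        e j]
      - starPhi0 ![D a c - D c a, e b, e i,
        e j]
      + starPhi0 ![D b c - D c b, e a, e i,
        e j] = 0 := by
    intro a b c i j hi hj
    have := q a b c i j
    rw [dU i hi a, dU i hi b, dU i hi c, dU i hi j, dU j hj a, dU j hj b, dU j hj c] at this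
    simp only [starPhi0_sub]
    linear_combination this
      - starPhi0_swap (e b) (D a c) (e i) (e j) + starPhi0_swap (e a) (D b c) (e i) (e j)
      - starPhi0_swap (e a) (D c b) (e i) (e j)
      - starPhi0_swap_right (e a) (e b) (e i) (D c j)
      + starPhi0_swap_middle (e a) (e c) (D b i) (e j)
      + starPhi0_swap_right (e a) (e c) (e i) (D b j)
      - starPhi0_swap_middle (e a) (e c) (D b j) (e i)
      - starPhi0_swap_middle (e b) (e c) (D a i) (e j) + starPhi0_swap (e b) (D a i) (e c) (e j)
      - starPhi0_swap_right (e b) (e c) (e i) (D a j)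
      + starPhi0_swap_middle (e b) (e c) (D a j) (e i) - starPhi0_swap (e b) (D a j) (e c) (e i)
  have comp0 : ∀ a b : Fin 7, ∀ k : Fin 7, k.val < 4 → (D a b - D b a) k = 0 := by
    intro a b k hk
    rw [PiLp.sub_apply, ← hD, ← hD, h1 k hk, sub_self]
  obtain ⟨tri, k3⟩ := torsion_system he pT qT comp0
  have k3' : ∀ a : Fin 7, ¬ 4 ≤ a.val → a ≠ 3 → D a 3 = D 3 a := by
    intro a ha ha3
    obtain ⟨h0, h1, h2⟩ := k3
    fin_cases a
    · exact sub_eq_zero.1 h0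
    · exact sub_eq_zero.1 h1
    · exact sub_eq_zero.1 h2
    all_goals simp at ha ha3
  have key : ∀ a b : Fin 7, D a b = D b a := by
    intro a b
    by_cases ha : 4 ≤ a.val
    · exact dU a ha b
    by_cases hb : 4 ≤ b.val
    · exact (dU b hb a).symm
    by_cases ha3 : a = 3
    · by_cases hb3 : b = 3
      · rw [ha3, hb3]
      · rw [ha3]
        exact (k3' b hb hb3).symm
    · have ha3' := Fin.val_ne_of_ne ha3
      by_cases hb3 : b = 3
      · rw [hb3]
        exact k3' a ha ha3
      · have hb3' := Fin.val_ne_of_ne hb3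
        exact tri a b (by simp at ha3'; omega) (by simp at hb3'; omega)
  have hbasis : ∀ x : R7, x = ∑ i, (E x) i • v i := by
    intro x
    apply E.injective
    rw [map_sum]
    simp only [map_smul, hv, ContinuousLinearEquiv.apply_symm_apply]
    ext i; simp [Finset.sum_apply, Pi.single_apply]
  rw [hbasis a, hbasis b]
  simp only [map_sum, map_smul, sum_apply, smul_apply, hD, Finset.smul_sum]
  rw [Finset.sum_comm]
  refine Finset.sum_congr rfl fun i _ => Finset.sum_congr rfl fun j _ => ?_
  rw [key, smul_comm]

/-! ### Cartan's formula for an invariant coframe -/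

section Flow

variable {W : Type*} [NormedAddCommGroup W] [NormedSpace ℝ W]

open Filter Topology in
/-- A coframe that is invariant under a local flow, and constant on its generator, has torsion
whose contraction with the generator vanishes. -/
theorem fderiv_apply_generator_comm {F : W × R7 → R7} {y : R7} (hF : ContDiffAt ℝ 2 F (0, y))
    (hF0 : ∀ᶠ z in 𝓝 y, F (0, z) = z) {R : R7 → R7 →L[ℝ] R7} {R' : R7 →L[ℝ] R7 →L[ℝ] R7}
    (hR : HasFDerivAt R R' y) (v : W)
    (hinv : ∀ᶠ t in 𝓝 (0 : W), ∀ a, R (F (t, y)) (fderiv ℝ F (t, y) (0, a)) = R y a) {c : R7}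
    (hc : ∀ᶠ z in 𝓝 y, R z (fderiv ℝ F (0, z) (v, 0)) = c) (a : R7) :
    R' (fderiv ℝ F (0, y) (v, 0)) a = R' a (fderiv ℝ F (0, y) (v, 0)) := by
  have hF' : HasFDerivAt F (fderiv ℝ F (0, y)) (0, y) :=
    (hF.differentiableAt (by norm_num)).hasFDerivAt
  have hF'' : HasFDerivAt (fderiv ℝ F) (fderiv ℝ (fderiv ℝ F) (0, y)) (0, y) :=
    ((hF.fderiv_right (m := 1) (by norm_num)).differentiableAt (by norm_num)).hasFDerivAt
  set F'' := fderiv ℝ (fderiv ℝ F) (0, y) with hF''def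
  have hsymm : ∀ p q, F'' p q = F'' q p :=
    hF.isSymmSndFDerivAt (by simp)
  have hF0y : F (0, y) = y := hF0.self_of_nhds
  have hid : fderiv ℝ F (0, y) (0, a) = a := by
    have h1 : HasFDerivAt (fun z : R7 => F (0, z)) (fderiv ℝ F (0, y) ∘L .inr ℝ W R7) y :=
      HasFDerivAt.comp y (f := fun z : R7 => ((0 : W), z)) hF' (hasFDerivAt_prodMk_right _ _)
    have h2 : HasFDerivAt (fun z : R7 => F (0, z)) (.id ℝ R7) y :=
      (hasFDerivAt_id y).congr_of_eventuallyEq hF0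
    exact DFunLike.congr_fun (h1.unique h2) a
  -- The Lie derivative of `R` along the generator vanishes: differentiate the invariance along `s ↦
  -- s • v` at `s = 0`.
  have e1 : R' (fderiv ℝ F (0, y) (v, 0)) a + R y (F'' (v, 0) (0, a)) = 0 := by
    have hl : HasDerivAt (fun s : ℝ => (s • v, y)) (v, (0 : R7)) 0 := by
      refine HasDerivAt.prodMk ?_ (hasDerivAt_const _ _)
      simpa using (hasDerivAt_id (0 : ℝ)).smul_const v
    have hl0 : ((0 : ℝ) • v, y) = ((0 : W), y) := by simp
    have h1 : HasDerivAt (fun s : ℝ => F (s • v, y)) (fderiv ℝ F (0, y) (v, 0)) 0 :=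
      HasFDerivAt.comp_hasDerivAt (0 : ℝ) (f := fun s : ℝ => (s • v, y)) (by rw [hl0]; exact hF') hl
    have h2 : HasDerivAt (fun s : ℝ => fderiv ℝ F (s • v, y)) (F'' (v, 0)) 0 :=
      HasFDerivAt.comp_hasDerivAt (0 : ℝ) (f := fun s : ℝ => (s • v, y)) (by rw [hl0]; exact hF'') hl
    have h3 : HasDerivAt (fun s : ℝ => R (F (s • v, y))) (R' (fderiv ℝ F (0, y) (v, 0))) 0 :=
      HasFDerivAt.comp_hasDerivAt (0 : ℝ) (f := fun s : ℝ => F (s • v, y))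
        (by rw [hl0, hF0y]; exact hR) h1
    have h4 := h3.clm_apply (h2.clm_apply (hasDerivAt_const (0 : ℝ) ((0 : W), a)))
    have h5 : HasDerivAt (fun s : ℝ => R (F (s • v, y)) (fderiv ℝ F (s • v, y) (0, a))) 0 0 := by
      refine (hasDerivAt_const (0 : ℝ) (R y a)).congr_of_eventuallyEq ?_
      have ht : Tendsto (fun s : ℝ => s • v) (𝓝 0) (𝓝 0) := by
        have : Continuous fun s : ℝ => s • v := by fun_prop
        simpa using this.tendsto 0
      filter_upwards [ht.eventually hinv] with s hs using hs a
    have h6 := h4.unique h5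
    rw [hl0, hF0y, hid] at h6
    simpa using h6
  -- The differential of the constant function `R(generator)` vanishes. The mixed second derivative
  -- of `F` is the same as in `e1`, so subtraction leaves the torsion alone.
  have e2 : R' a (fderiv ℝ F (0, y) (v, 0)) + R y (F'' (0, a) (v, 0)) = 0 := by
    have hp : HasFDerivAt (fun z : R7 => ((0 : W), z)) (.inr ℝ W R7) y := hasFDerivAt_prodMk_right _ _
    have h2 : HasFDerivAt (fun z : R7 => fderiv ℝ F (0, z)) (F'' ∘L .inr ℝ W R7) y :=
      HasFDerivAt.comp y (f := fun z : R7 => ((0 : W), z)) hF'' hp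
    have h3 := hR.clm_apply (h2.clm_apply (hasFDerivAt_const ((v, (0 : R7)) : W × R7) y))
    have h4 : HasFDerivAt (fun z : R7 => R z (fderiv ℝ F (0, z) (v, 0))) (0 : R7 →L[ℝ] R7) y :=
      (hasFDerivAt_const c y).congr_of_eventuallyEq hc
    have h5 := DFunLike.congr_fun (h3.unique h4) a
    simpa [add_comm] using h5
  rw [hsymm] at e1
  exact add_right_cancel (e1.trans e2.symm)

end Flow

/-! ### Curvature of the metric of a closed coframe -/

section Curvature

variable {M : Type*} [TopologicalSpace M] [ChartedSpace R7 M]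

theorem metricMatrix_eq_mul {g : TangentProduct M} {x : M} {R : R7 → R7 →L[ℝ] R7} {z : R7}
    (hg : ∀ i j, metricMatrix g x z i j =
      inner ℝ (R z (EuclideanSpace.single i 1)) (R z (EuclideanSpace.single j 1))) :
    metricMatrix g x z = (stdMatrix (R z)).transpose * stdMatrix (R z) := by
  ext i j
  rw [hg, PiLp.inner_apply, Matrix.mul_apply]
  simp [stdMatrix, mul_comm]

open Filter Topology in
/-- The Christoffel symbols of the metric of a closed coframe. -/
theorem christoffel_of_closed_coframe {g : TangentProduct M} {x : M} {R : R7 → R7 →L[ℝ] R7}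
    {z : R7} (hR : DifferentiableAt ℝ R z)
    (hg : ∀ᶠ w in 𝓝 z, ∀ i j, metricMatrix g x w i j =
      inner ℝ (R w (EuclideanSpace.single i 1)) (R w (EuclideanSpace.single j 1)))
    (hu : IsUnit (R z)) (hsymm : ∀ a b, fderiv ℝ R z a b = fderiv ℝ R z b a) (k i j : Fin 7) :
    christoffel g x k i j z = Ring.inverse (R z)
      (fderiv ℝ R z (EuclideanSpace.single i 1) (EuclideanSpace.single j 1)) k := by
  set e : Fin 7 → R7 := fun i => EuclideanSpace.single i 1 with he
  have hd : ∀ i j l, partialDeriv i (fun w => metricMatrix g x w j l) z =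
      inner ℝ (fderiv ℝ R z (e i) (e j)) (R z (e l)) + inner ℝ (R z (e j)) (fderiv ℝ R z (e i) (e l)) := by
    intro i j l
    have h1 : ∀ m, HasFDerivAt (fun w => R w (e m)) ((fderiv ℝ R z).flip (e m)) z := fun m => by
      simpa using hR.hasFDerivAt.clm_apply (hasFDerivAt_const (e m) z)
    have h2 := (h1 j).inner ℝ (h1 l)
    have h3 := h2.congr_of_eventuallyEq (f₁ := fun w => metricMatrix g x w j l)
      (by filter_upwards [hg] with w hw using hw j l)
    rw [partialDeriv, h3.fderiv]
    simp [fderivInnerCLM_apply, he, add_comm]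
  have hmat := metricMatrix_eq_mul hg.self_of_nhds
  set J := stdMatrix (R z) with hJ
  set S : R7 →L[ℝ] R7 := Ring.inverse (R z) with hS
  have hRS : ∀ w, R z (S w) = w := fun w => by
    have := Ring.mul_inverse_cancel _ hu
    exact DFunLike.congr_fun this w
  have hJdet : IsUnit J.det := by
    have : J * stdMatrix S = 1 := by
      apply Matrix.ext_of_mulVec_single
      intro m
      have e1 := apply_eq_stdMatrix_mulVec S (EuclideanSpace.single m 1)
      rw [PiLp.ofLp_single] at e1
      rw [← Matrix.mulVec_mulVec, ← e1, hJ, ← apply_eq_stdMatrix_mulVec, hRS]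
      ext k
      simp [Matrix.one_apply]
    exact (Matrix.isUnit_iff_isUnit_det _).1 (IsUnit.of_mul_eq_one _ this)
  have hmdet : IsUnit (J.transpose * J).det := by
    rw [Matrix.det_mul, Matrix.det_transpose]; exact hJdet.mul hJdet
  -- This is `R⁻¹ = (JᵀJ)⁻¹ Jᵀ`, with the metric matrix equal to `JᵀJ`.
  have key : ∀ H : R7, ∑ l, (metricMatrix g x z)⁻¹ k l * inner ℝ H (R z (e l)) = S H k := by
    intro H
    have h1 : (S H).ofLp = ((J.transpose * J)⁻¹).mulVec ((J.transpose).mulVec H.ofLp) := by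
      conv_rhs => rw [← hRS H, apply_eq_stdMatrix_mulVec, ← hJ, Matrix.mulVec_mulVec, Matrix.mulVec_mulVec,
        Matrix.mul_assoc, Matrix.nonsing_inv_mul _ hmdet, Matrix.one_mulVec]
    rw [h1, hmat]
    simp only [Matrix.mulVec, dotProduct]
    refine Finset.sum_congr rfl fun l _ => ?_
    congr 1
  rw [christoffel]
  simp only [hd]
  -- Closedness lets the two derivative directions be exchanged, so the terms pairing with `R (e i)`
  -- and `R (e j)` cancel and the other two coincide.
  have hsum : ∀ l, (inner ℝ (fderiv ℝ R z (e i) (e j)) (R z (e l))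
      + inner ℝ (R z (e j)) (fderiv ℝ R z (e i) (e l))
      + (inner ℝ (fderiv ℝ R z (e j) (e i)) (R z (e l))
      + inner ℝ (R z (e i)) (fderiv ℝ R z (e j) (e l)))
      - (inner ℝ (fderiv ℝ R z (e l) (e i)) (R z (e j))
      + inner ℝ (R z (e i)) (fderiv ℝ R z (e l) (e j))) : ℝ) =
      2 * inner ℝ (fderiv ℝ R z (e i) (e j)) (R z (e l)) := by
    intro l
    rw [hsymm (e j) (e i), hsymm (e l) (e i), hsymm (e l) (e j),
      real_inner_comm (R z (e j)) (fderiv ℝ R z (e i) (e l))]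
    ring
  have h2 : ∀ l, (metricMatrix g x z)⁻¹ k l *
      (2 * inner ℝ (fderiv ℝ R z (e i) (e j)) (R z (e l))) =
      2 * ((metricMatrix g x z)⁻¹ k l * inner ℝ (fderiv ℝ R z (e i) (e j)) (R z (e l))) :=
    fun l => by ring
  simp only [hsum, h2, ← Finset.mul_sum, key]
  ring

/-- The metric of a closed coframe is flat. -/
theorem riemannCurvature_of_closed_coframe {g : TangentProduct M} {x : M} {Ω : Set R7}
    (hΩ : IsOpen Ω) {R : R7 → R7 →L[ℝ] R7} (hR : ContDiffOn ℝ 2 R Ω)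
    (hg : ∀ w ∈ Ω, ∀ i j, metricMatrix g x w i j =
      inner ℝ (R w (EuclideanSpace.single i 1)) (R w (EuclideanSpace.single j 1)))
    (hu : ∀ w ∈ Ω, IsUnit (R w)) (hsymm : ∀ w ∈ Ω, ∀ a b, fderiv ℝ R w a b = fderiv ℝ R w b a)
    {z : R7} (hz : z ∈ Ω) (l i j k : Fin 7) : riemannCurvature g x l i j k z = 0 := by
  have hRz : ∀ w ∈ Ω, ContDiffAt ℝ 2 R w := fun w hw => hR.contDiffAt (hΩ.mem_nhds hw)
  have hch : ∀ w ∈ Ω, ∀ k i j, christoffel g x k i j w =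
      Ring.inverse (R w)
        (fderiv ℝ R w (EuclideanSpace.single i 1) (EuclideanSpace.single j 1)) k :=
    fun w hw => christoffel_of_closed_coframe ((hRz w hw).differentiableAt (by norm_num))
      (by filter_upwards [hΩ.mem_nhds hw] with v hv using hg v hv) (hu w hw) (hsymm w hw)
  set e : Fin 7 → R7 := fun i => EuclideanSpace.single i 1 with he
  set R'' := fderiv ℝ (fderiv ℝ R) z with hR''
  have h2 : HasFDerivAt (fderiv ℝ R) R'' z :=
    (((hRz z hz).fderiv_right (m := 1) (by norm_num)).differentiableAt (by norm_num)).hasFDerivAt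
  have hs2 : ∀ a b, R'' a b = R'' b a := (hRz z hz).isSymmSndFDerivAt (by simp)
  have h1 : HasFDerivAt R (fderiv ℝ R z) z := ((hRz z hz).differentiableAt (by norm_num)).hasFDerivAt
  obtain ⟨U, hU⟩ := hu z hz
  have : IsScalarTower ℝ (R7 →L[ℝ] R7) (R7 →L[ℝ] R7) := ⟨fun a b c => by ext; simp⟩
  have : SMulCommClass ℝ (R7 →L[ℝ] R7) (R7 →L[ℝ] R7) := ⟨fun a b c => by ext; simp⟩
  have hinv : HasFDerivAt (fun w => Ring.inverse (R w))
      ((-ContinuousLinearMap.mulLeftRight ℝ (R7 →L[ℝ] R7) ↑U⁻¹ ↑U⁻¹) ∘L fderiv ℝ R z) z := by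
    have := hasFDerivAt_ringInverse (𝕜 := ℝ) U
    rw [hU] at this
    exact this.comp z h1
  set S : R7 →L[ℝ] R7 := ↑U⁻¹ with hS
  have hSz : Ring.inverse (R z) = S := by rw [← hU, Ring.inverse_unit]
  have hd : ∀ a b m n : Fin 7, partialDeriv a (christoffel g x m b n) z =
      (S (R'' (e a) (e b) (e n)) - S (fderiv ℝ R z (e a) (S (fderiv ℝ R z (e b) (e n))))) m := by
    intro a b m n
    have h3 := hinv.clm_apply ((h2.clm_apply (hasFDerivAt_const (e b) z)).clm_apply
      (hasFDerivAt_const (e n) z))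
    have h4 := ((EuclideanSpace.proj m : R7 →L[ℝ] ℝ).hasFDerivAt.comp z h3)
    have h5 := h4.congr_of_eventuallyEq (f₁ := christoffel g x m b n)
      (by filter_upwards [hΩ.mem_nhds hz] with w hw using hch w hw m b n)
    rw [partialDeriv, h5.fderiv]
    simp [hSz, he, sub_eq_add_neg]
  have hsum : ∀ a b : Fin 7, ∑ m, christoffel g x l a m z * christoffel g x m b k z =
      S (fderiv ℝ R z (e a) (S (fderiv ℝ R z (e b) (e k)))) l := by
    intro a b
    have hX : ∀ X : R7, X = ∑ m, X m • e m := fun X => by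
      ext i; simp [Finset.sum_apply, Pi.single_apply, he]
    conv_rhs => rw [hX (S (fderiv ℝ R z (e b) (e k))), map_sum, map_sum]
    simp only [hch z hz, hSz, map_smul]
    simp [mul_comm, he]
  -- The products of Christoffel symbols cancel the terms from differentiating `R⁻¹`; the remaining
  -- second derivatives of `R` are symmetric in `i` and `j`.
  rw [riemannCurvature, Finset.sum_sub_distrib, hsum, hsum, hd, hd, hs2 (e j) (e i)]
  simp
end Curvature

/-! ### The torus exponential and the infinitesimal action -/

theorem torusExp_zero : torusExp 0 = 1 := by
  simp [torusExp]

theorem torusExp_add (s t : Fin 3 → ℝ) : torusExp (s + t) = torusExp s * torusExp t := by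
  simp [torusExp, Circle.exp_add]

theorem contMDiff_torusExp {n : WithTop ℕ∞} :
    ContMDiff 𝓘(ℝ, Fin 3 → ℝ) ((𝓡 1).prod ((𝓡 1).prod (𝓡 1))) n torusExp := by
  have h : ∀ i : Fin 3, ContMDiff 𝓘(ℝ, Fin 3 → ℝ) (𝓡 1) n fun t : Fin 3 → ℝ => Circle.exp (t i) :=
    fun i => contMDiff_circleExp.comp (contDiff_apply ℝ ℝ i).contMDiff
  exact (h 0).prodMk ((h 1).prodMk (h 2))

section Action

variable {M : Type*} [TopologicalSpace M] [ChartedSpace R7 M] [MulAction Torus3 M]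
  [ContMDiffSMul ((𝓡 1).prod ((𝓡 1).prod (𝓡 1))) (𝓡 7) ∞ Torus3 M]

theorem contMDiff_smul_left (t : Torus3) : ContMDiff (𝓡 7) (𝓡 7) ∞ fun q : M => t • q :=
  ContMDiffSMul.contMDiff_const_smul (I := (𝓡 1).prod ((𝓡 1).prod (𝓡 1))) t

theorem contMDiff_torusExp_smul (p : M) :
    ContMDiff 𝓘(ℝ, Fin 3 → ℝ) (𝓡 7) ∞ fun t : Fin 3 → ℝ => torusExp t • p :=
  ContMDiff.smul (I := (𝓡 1).prod ((𝓡 1).prod (𝓡 1))) contMDiff_torusExp contMDiff_const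

theorem hasMFDerivAt_infAction (p : M) :
    HasMFDerivAt 𝓘(ℝ, Fin 3 → ℝ) (𝓡 7) (fun t : Fin 3 → ℝ => torusExp t • p) 0 (infAction p) :=
  ((contMDiff_torusExp_smul p).mdifferentiableAt (by simp)).hasMFDerivAt

theorem hasMFDerivAt_smul_left (t : Torus3) (p : M) :
    HasMFDerivAt (𝓡 7) (𝓡 7) (fun q : M => t • q) p (mfderiv (𝓡 7) (𝓡 7) (fun q : M => t • q) p) :=
  ((contMDiff_smul_left t).mdifferentiableAt (by simp)).hasMFDerivAt

/-- The torus is abelian, so translating by `t` carries the curve `exp(s)·p` to `exp(s)·(t·p)`;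
there is no adjoint twist of `v`. -/
theorem infAction_smul (t : Torus3) (p : M) (v : Fin 3 → ℝ) :
    infAction (t • p) v = mfderiv (𝓡 7) (𝓡 7) (fun q : M => t • q) p (infAction p v) := by
  have h0 : torusExp 0 • p = p := by rw [torusExp_zero, one_smul]
  have h1 := hasMFDerivAt_smul_left (M := M) t (torusExp 0 • p)
  have h2 := HasMFDerivAt.comp (0 : Fin 3 → ℝ) h1 (hasMFDerivAt_infAction p)
  have h3 : ((fun q : M => t • q) ∘ fun s : Fin 3 → ℝ => torusExp s • p) =
      fun s : Fin 3 → ℝ => torusExp s • (t • p) := by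
    ext s; exact smul_comm t (torusExp s) p
  rw [h3] at h2
  have h4 := hasMFDerivAt_unique h2 (hasMFDerivAt_infAction (t • p))
  have h5 := DFunLike.congr_fun h4 v
  -- `torusExp 0 • p` equals `p` only propositionally. Both tangent spaces unfold to `R7`, where the
  -- two differentials can be compared.
  have h6 : ∀ q : M, q = p → ∀ X : R7, (mfderiv (𝓡 7) (𝓡 7) (fun q : M => t • q) q : R7 → R7) X =
      (mfderiv (𝓡 7) (𝓡 7) (fun q : M => t • q) p : R7 → R7) X := by
    rintro q rfl X; rfl
  exact h5.symm.trans (h6 _ h0 _)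

end Action

/-! ### The stabiliser of the model form -/

theorem eq_zero_of_cross_eq_zero {X : R7} (h : ∀ Y, cross X Y = 0) : X = 0 := by
  have h0 := h (EuclideanSpace.single 0 1)
  have h1 := h (EuclideanSpace.single 1 1)
  have c0 := fun i : Fin 7 => congrArg (fun v : R7 => v i) h0
  have c1 := congrArg (fun v : R7 => v 2) h1
  have k1 := c0 1
  have k2 := c0 2
  have k3 := c0 3
  have k4 := c0 4
  have k5 := c0 5
  have k6 := c0 6
  simp [cross] at k1 k2 k3 k4 k5 k6 c1
  exact ext_R7 c1 k2 k1 k4 k3 k6 k5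

theorem phi0_comp_apply (O : R7 →L[ℝ] R7) (X Y Z : R7) :
    phi0.compContinuousLinearMap O ![X, Y, Z] = phi0 ![O X, O Y, O Z] := by
  rw [ContinuousAlternatingMap.compContinuousLinearMap_apply]
  congr 1; ext i; fin_cases i <;> rfl

theorem starPhi0_comp_apply (O : R7 →L[ℝ] R7) (X Y Z W : R7) :
    starPhi0.compContinuousLinearMap O ![X, Y, Z, W] = starPhi0 ![O X, O Y, O Z, O W] := by
  rw [ContinuousAlternatingMap.compContinuousLinearMap_apply]
  congr 1; ext i; fin_cases i <;> rfl

section Stabiliser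

variable {O : R7 →L[ℝ] R7} (hO : phi0.compContinuousLinearMap O = phi0)

include hO

theorem phi0_map_of_stabiliser (X Y Z : R7) : phi0 ![O X, O Y, O Z] = phi0 ![X, Y, Z] := by
  rw [← phi0_comp_apply, hO]

/-- Invertibility of `O` is not assumed: a kernel vector of `O` would be annihilated by the
nondegenerate form `phi0`. -/
theorem injective_of_stabiliser : Function.Injective O := by
  rw [injective_iff_map_eq_zero]
  intro X hX
  refine eq_zero_of_cross_eq_zero fun Y => ext_inner_right ℝ fun Z => ?_
  rw [← phi0_eq_inner, ← phi0_map_of_stabiliser hO, hX, phi0_eq_inner, ← crossₗ_apply]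
  simp

/-- `O` and the identity pull `phi0` back to the same form, and by `gramOf_comp` that form
determines the Gram matrix. -/
theorem inner_map_of_stabiliser (X Y : R7) : inner ℝ (O X) (O Y) = inner ℝ X Y := by
  have hX : ∀ X : R7, X = ∑ m, X m • EuclideanSpace.single m (1 : ℝ) := fun X => by
    ext i; simp [Finset.sum_apply, Pi.single_apply]
  set E : R7 ≃L[ℝ] R7 :=
    (LinearEquiv.ofInjectiveEndo O.toLinearMap (injective_of_stabiliser hO)).toContinuousLinearEquiv
  have hE : (E : R7 →L[ℝ] R7) = O := by ext1 X; rfl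
  have hEx : ∀ X, E X = O X := fun X => rfl
  have key : ∀ i j : Fin 7, inner ℝ (O (EuclideanSpace.single i 1)) (O (EuclideanSpace.single j 1)) =
      inner ℝ (EuclideanSpace.single i 1 : R7) (EuclideanSpace.single j 1) := by
    intro i j
    have h1 := gramOf_comp E i j
    have h2 := gramOf_comp (ContinuousLinearEquiv.refl ℝ R7) i j
    have h3 : phi0.compContinuousLinearMap ((ContinuousLinearEquiv.refl ℝ R7 : R7 ≃L[ℝ] R7) : R7 →L[ℝ] R7) = phi0 := by
      ext; rfl
    rw [hE, hO] at h1
    rw [h3] at h2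
    exact h1.symm.trans h2
  conv_lhs => rw [hX X, hX Y, map_sum, map_sum]
  conv_rhs => rw [hX X, hX Y]
  simp only [sum_inner, inner_sum, map_smul, inner_smul_left, inner_smul_right, key]

theorem cross_map_of_stabiliser (X Y : R7) : cross (O X) (O Y) = O (cross X Y) := by
  have hs : Function.Surjective O :=
    LinearMap.surjective_of_injective (f := O.toLinearMap) (injective_of_stabiliser hO)
  refine ext_inner_right ℝ fun Z => ?_
  obtain ⟨Z, rfl⟩ := hs Z
  rw [inner_map_of_stabiliser hO, ← phi0_eq_inner, ← phi0_eq_inner, phi0_map_of_stabiliser hO]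

theorem adaptedMap_map_of_stabiliser (a b c X : R7) :
    adaptedMap (O a) (O b) (O c) (O X) = adaptedMap a b c X := by
  simp only [adaptedMap, LinearMap.coe_mk, AddHom.coe_mk, cross_map_of_stabiliser hO,
    inner_map_of_stabiliser hO]

end Stabiliser

/-! ### The adapted coframe -/

theorem G2Structure.form_eq {M : Type*} [TopologicalSpace M] [ChartedSpace R7 M]
    (G : G2Structure M) (p : M) : G.form p =
    phi0.compContinuousLinearMap (G.frame p : TangentSpace (𝓡 7) p →L[ℝ] R7) :=
  (G.adapted p).choose_spec

section Coframe

variable {M : Type*} [TopologicalSpace M] [ChartedSpace R7 M] [MulAction Torus3 M]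
  (G : G2Structure M)

/-- The coframe adapted to the action with respect to a basis `w` of the Lie algebra. -/
def G2Structure.coframe (w : Fin 3 → Fin 3 → ℝ) (p : M) : TangentSpace (𝓡 7) p →L[ℝ] R7 :=
  (adaptedMap (G.frame p (infAction p (w 0))) (G.frame p (infAction p (w 1)))
    (G.frame p (infAction p (w 2)))).toContinuousLinearMap ∘L
    (G.frame p : TangentSpace (𝓡 7) p →L[ℝ] R7)

theorem G2Structure.coframe_apply (w : Fin 3 → Fin 3 → ℝ) (p : M) (X : TangentSpace (𝓡 7) p) :
    G.coframe w p X = adaptedMap (G.frame p (infAction p (w 0))) (G.frame p (infAction p (w 1)))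
    (G.frame p (infAction p (w 2))) (G.frame p X) := rfl

/-- The comparison of the adapted frames at `p` and `t • p`. -/
def G2Structure.transition (t : Torus3) (p : M) : R7 →L[ℝ] R7 :=
  (G.frame (t • p) : TangentSpace (𝓡 7) (t • p) →L[ℝ] R7) ∘L
    mfderiv (𝓡 7) (𝓡 7) (fun q : M => t • q) p ∘L
    ((G.frame p).symm : R7 →L[ℝ] TangentSpace (𝓡 7) p)

theorem G2Structure.phi0_comp_transition (hG : G.form.IsInvariant) (t : Torus3) (p : M) :
    phi0.compContinuousLinearMap (G.transition t p) = phi0 := by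
  have h := hG t p
  rw [G.form_eq, G.form_eq] at h
  ext v
  have h' := DFunLike.congr_fun h (fun i => (G.frame p).symm (v i))
  simp only [ContinuousAlternatingMap.compContinuousLinearMap_apply] at h' ⊢
  refine Eq.trans h' ?_
  congr 1
  ext1 i
  exact (G.frame p).apply_symm_apply (v i)

theorem G2Structure.transition_frame (t : Torus3) (p : M) (X : TangentSpace (𝓡 7) p) :
    G.transition t p (G.frame p X) =
      G.frame (t • p) (mfderiv (𝓡 7) (𝓡 7) (fun q : M => t • q) p X) := by
  change G.frame (t • p) (mfderiv (𝓡 7) (𝓡 7) (fun q : M => t • q) p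
    ((G.frame p).symm (G.frame p X))) = _
  rw [(G.frame p).symm_apply_apply]

/-- The chosen frames at `p` and `t • p` need not correspond under the action, but they differ by an
element of the stabiliser of `phi0`, and `adaptedMap` is built only from inner and cross products.
-/
theorem G2Structure.coframe_smul [ContMDiffSMul ((𝓡 1).prod ((𝓡 1).prod (𝓡 1))) (𝓡 7) ∞ Torus3 M]
    (hG : G.form.IsInvariant) (w : Fin 3 → Fin 3 → ℝ)
    (t : Torus3) (p : M) (X : TangentSpace (𝓡 7) p) :
    G.coframe w (t • p) (mfderiv (𝓡 7) (𝓡 7) (fun q : M => t • q) p X) = G.coframe w p X := by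
  rw [G.coframe_apply, G.coframe_apply, infAction_smul, infAction_smul, infAction_smul,
    ← G.transition_frame, ← G.transition_frame, ← G.transition_frame, ← G.transition_frame,
    adaptedMap_map_of_stabiliser (G.phi0_comp_transition hG t p)]

end Coframe

theorem torusExp_zero_smul_symm {M : Type*} [TopologicalSpace M] [ChartedSpace R7 M]
    [MulAction Torus3 M] (x : M) (y : R7) :
    torusExp 0 • (extChartAt (𝓡 7) x).symm y = (extChartAt (𝓡 7) x).symm y := by
  rw [torusExp_zero, one_smul]

/-! ### The action and the `G₂`-structure in charts -/

section Chart

variable {M : Type*} [TopologicalSpace M] [ChartedSpace R7 M]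

open Filter Topology

theorem isOpen_chart_target (x : M) : IsOpen (extChartAt (𝓡 7) x).target :=
  isOpen_extChartAt_target x

section Smooth

variable [IsManifold (𝓡 7) ∞ M]

theorem contMDiffAt_chart_symm {x : M} {y : R7} (hy : y ∈ (extChartAt (𝓡 7) x).target) :
    ContMDiffAt 𝓘(ℝ, R7) (𝓡 7) ∞ (extChartAt (𝓡 7) x).symm y :=
  (contMDiffOn_extChartAt_symm x).contMDiffAt ((isOpen_chart_target x).mem_nhds hy)

theorem contMDiffAt_chart {x q : M} (hq : q ∈ (extChartAt (𝓡 7) x).source) :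
    ContMDiffAt (𝓡 7) 𝓘(ℝ, R7) ∞ (extChartAt (𝓡 7) x) q :=
  contMDiffAt_extChartAt' (by rwa [extChartAt_source] at hq)

theorem hasMFDerivAt_paramDeriv {x : M} {y : R7} (hy : y ∈ (extChartAt (𝓡 7) x).target) :
    HasMFDerivAt 𝓘(ℝ, R7) (𝓡 7) (extChartAt (𝓡 7) x).symm y (paramDeriv x y) :=
  ((contMDiffAt_chart_symm hy).mdifferentiableAt (by simp)).hasMFDerivAt

theorem mfderiv_chart_paramDeriv {x : M} {y : R7} (hy : y ∈ (extChartAt (𝓡 7) x).target) (X : R7) :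
    mfderiv (𝓡 7) 𝓘(ℝ, R7) (extChartAt (𝓡 7) x) ((extChartAt (𝓡 7) x).symm y)
      (paramDeriv x y X) = X := by
  have hq := (extChartAt (𝓡 7) x).map_target hy
  have h1 := ((contMDiffAt_chart hq).mdifferentiableAt (by simp)).hasMFDerivAt
  have h2 := HasMFDerivAt.comp y h1 (hasMFDerivAt_paramDeriv hy)
  have h3 : HasMFDerivAt 𝓘(ℝ, R7) 𝓘(ℝ, R7) ((extChartAt (𝓡 7) x) ∘ (extChartAt (𝓡 7) x).symm) y
      (ContinuousLinearMap.id ℝ R7) := by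
    refine (hasMFDerivAt_id y).congr_of_eventuallyEq ?_
    filter_upwards [(isOpen_chart_target x).mem_nhds hy] with z hz
    exact (extChartAt (𝓡 7) x).right_inv hz
  exact DFunLike.congr_fun (hasMFDerivAt_unique h2 h3) X

theorem paramDeriv_mfderiv_chart {x q : M} (hq : q ∈ (extChartAt (𝓡 7) x).source)
    (X : TangentSpace (𝓡 7) q) :
    (paramDeriv x (extChartAt (𝓡 7) x q) : R7 → R7)
      (mfderiv (𝓡 7) 𝓘(ℝ, R7) (extChartAt (𝓡 7) x) q X) = (X : R7) := by
  have hy := (extChartAt (𝓡 7) x).map_source hq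
  have h1 := ((contMDiffAt_chart hq).mdifferentiableAt (by simp)).hasMFDerivAt
  have h2 := HasMFDerivAt.comp q (hasMFDerivAt_paramDeriv hy) h1
  have h3 : HasMFDerivAt (𝓡 7) (𝓡 7) ((extChartAt (𝓡 7) x).symm ∘ (extChartAt (𝓡 7) x)) q
      (ContinuousLinearMap.id ℝ R7) := by
    refine (hasMFDerivAt_id q).congr_of_eventuallyEq ?_
    filter_upwards [(isOpen_extChartAt_source x).mem_nhds hq] with z hz
    exact (extChartAt (𝓡 7) x).left_inv hz
  exact DFunLike.congr_fun (hasMFDerivAt_unique h2 h3) X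

theorem injective_paramDeriv {x : M} {y : R7} (hy : y ∈ (extChartAt (𝓡 7) x).target) :
    Function.Injective (paramDeriv x y : R7 → R7) :=
  Function.LeftInverse.injective (mfderiv_chart_paramDeriv hy)

end Smooth

/-- The torus action in a chart. -/
def chartAction [MulAction Torus3 M] (x : M) (p : (Fin 3 → ℝ) × R7) : R7 :=
  extChartAt (𝓡 7) x (torusExp p.1 • (extChartAt (𝓡 7) x).symm p.2)

theorem chartAction_zero [MulAction Torus3 M] {x : M} {y : R7} (hy : y ∈ (extChartAt (𝓡 7) x).target) :
    chartAction x (0, y) = y := by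
  rw [chartAction, torusExp_zero_smul_symm, (extChartAt (𝓡 7) x).right_inv hy]

variable (G : G2Structure M)

/-- The adapted frame of a `G₂`-structure in a chart. -/
def G2Structure.chartFrame (x : M) (y : R7) : R7 →L[ℝ] R7 :=
  (G.frame ((extChartAt (𝓡 7) x).symm y) : TangentSpace (𝓡 7) _ →L[ℝ] R7) ∘L paramDeriv x y

theorem G2Structure.inChart_form (x : M) (y : R7) :
    G.form.inChart x y = phi0.compContinuousLinearMap (G.chartFrame x y) := by
  rw [DiffForm.inChart, G.form_eq]
  rfl

theorem G2Structure.inChart_starForm (x : M) (y : R7) :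
    G.starForm.inChart x y = starPhi0.compContinuousLinearMap (G.chartFrame x y) := rfl

theorem G2Structure.metricMatrix_eq (x : M) (y : R7) (i j : Fin 7) :
    metricMatrix G.metric x y i j = inner ℝ (G.chartFrame x y (EuclideanSpace.single i 1))
      (G.chartFrame x y (EuclideanSpace.single j 1)) := rfl

theorem G2Structure.inner_chartFrame (x : M) (y X Y : R7) :
    inner ℝ (G.chartFrame x y X) (G.chartFrame x y Y) =
      ∑ i, ∑ j, X i * Y j * metricMatrix G.metric x y i j := by
  have hX : ∀ X : R7, X = ∑ m, X m • EuclideanSpace.single m (1 : ℝ) := fun X => by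
    ext i; simp [Finset.sum_apply, Pi.single_apply]
  conv_lhs => rw [hX X, hX Y, map_sum, map_sum]
  simp only [sum_inner, inner_sum, map_smul, inner_smul_left, inner_smul_right,
    G.metricMatrix_eq, Finset.mul_sum]
  rw [Finset.sum_comm]
  refine Finset.sum_congr rfl fun i _ => Finset.sum_congr rfl fun j _ => ?_
  rw [conj_trivial]
  ring

theorem G2Structure.contDiffAt_inChart {x : M} {y : R7} (hy : y ∈ (extChartAt (𝓡 7) x).target) :
    ContDiffAt ℝ ∞ (G.form.inChart x) y :=
  (G.smooth x).contDiffAt ((isOpen_chart_target x).mem_nhds hy)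

variable [IsManifold (𝓡 7) ∞ M]

theorem G2Structure.exists_equiv_chartFrame {x : M} {y : R7}
    (hy : y ∈ (extChartAt (𝓡 7) x).target) :
    ∃ L : R7 ≃L[ℝ] R7, (L : R7 →L[ℝ] R7) = G.chartFrame x y := by
  have hinj : Function.Injective (G.chartFrame x y) := by
    intro a b hab
    exact injective_paramDeriv hy ((G.frame _).injective hab)
  refine ⟨(LinearEquiv.ofInjectiveEndo (G.chartFrame x y).toLinearMap hinj).toContinuousLinearEquiv,
    ?_⟩
  ext1 X; rfl

/-- `G.frame` is a pointwise choice with no continuity. The metric is nevertheless smooth because it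
is `gramOf` of the smooth three-form. -/
theorem G2Structure.contDiffAt_metricMatrix {x : M} {y : R7}
    (hy : y ∈ (extChartAt (𝓡 7) x).target) (i j : Fin 7) :
    ContDiffAt ℝ ∞ (fun z => metricMatrix G.metric x z i j) y := by
  obtain ⟨L, hL⟩ := G.exists_equiv_chartFrame hy
  have h := (G.contDiffAt_inChart hy).gramOf (L := L) (by rw [hL, G.inChart_form]) i j
  refine h.congr_of_eventuallyEq ?_
  filter_upwards [(isOpen_chart_target x).mem_nhds hy] with z hz
  obtain ⟨L, hL⟩ := G.exists_equiv_chartFrame hz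
  rw [G.inChart_form, ← hL, gramOf_comp, G.metricMatrix_eq, ← hL]
  rfl

variable [MulAction Torus3 M] [ContMDiffSMul ((𝓡 1).prod ((𝓡 1).prod (𝓡 1))) (𝓡 7) ∞ Torus3 M]

theorem contMDiffAt_torusExp_smul_symm {x : M} {y : R7} (hy : y ∈ (extChartAt (𝓡 7) x).target)
    (t : Fin 3 → ℝ) : ContMDiffAt 𝓘(ℝ, (Fin 3 → ℝ) × R7) (𝓡 7) ∞
      (fun p : (Fin 3 → ℝ) × R7 => torusExp p.1 • (extChartAt (𝓡 7) x).symm p.2) (t, y) := by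
  refine ContMDiffAt.smul (I := (𝓡 1).prod ((𝓡 1).prod (𝓡 1))) ?_ ?_
  · exact (contMDiff_torusExp.comp contDiff_fst.contMDiff).contMDiffAt
  · exact ContMDiffAt.comp (t, y) (contMDiffAt_chart_symm hy) contDiff_snd.contMDiff.contMDiffAt

theorem contDiffAt_chartAction {x : M} {y : R7} (hy : y ∈ (extChartAt (𝓡 7) x).target) :
    ContDiffAt ℝ ∞ (chartAction x) (0, y) := by
  have hq := (extChartAt (𝓡 7) x).map_target hy
  rw [← torusExp_zero_smul_symm] at hq
  exact (ContMDiffAt.comp ((0 : Fin 3 → ℝ), y) (contMDiffAt_chart hq)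
    (contMDiffAt_torusExp_smul_symm hy 0)).contDiffAt

theorem eventually_chartAction_mem {x : M} {y : R7} (hy : y ∈ (extChartAt (𝓡 7) x).target) :
    ∀ᶠ p : (Fin 3 → ℝ) × R7 in 𝓝 (0, y),
      torusExp p.1 • (extChartAt (𝓡 7) x).symm p.2 ∈ (extChartAt (𝓡 7) x).source := by
  have hq := (extChartAt (𝓡 7) x).map_target hy
  rw [← torusExp_zero_smul_symm] at hq
  exact (contMDiffAt_torusExp_smul_symm hy 0).continuousAt
    ((isOpen_extChartAt_source x).mem_nhds hq)

/-- The infinitesimal action in a chart. -/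
def chartGenerator (x : M) (v : Fin 3 → ℝ) (y : R7) : R7 :=
  fderiv ℝ (chartAction x) (0, y) (v, 0)

theorem paramDeriv_chartGenerator {x : M} {y : R7} (hy : y ∈ (extChartAt (𝓡 7) x).target)
    (v : Fin 3 → ℝ) :
    paramDeriv x y (chartGenerator x v y) = infAction ((extChartAt (𝓡 7) x).symm y) v := by
  have h1 : HasFDerivAt (fun s : Fin 3 → ℝ => chartAction x (s, y))
      (fderiv ℝ (chartAction x) (0, y) ∘L .inl ℝ (Fin 3 → ℝ) R7) 0 :=
    HasFDerivAt.comp (0 : Fin 3 → ℝ) (f := fun s : Fin 3 → ℝ => (s, y))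
      ((contDiffAt_chartAction hy).differentiableAt (by simp)).hasFDerivAt
      (hasFDerivAt_prodMk_left _ _)
  have h0 : chartAction x (0, y) ∈ (extChartAt (𝓡 7) x).target := by
    rwa [chartAction_zero hy]
  have h2 := HasMFDerivAt.comp (0 : Fin 3 → ℝ) (f := fun s : Fin 3 → ℝ => chartAction x (s, y))
    (hasMFDerivAt_paramDeriv h0) h1.hasMFDerivAt
  have hev : (fun s : Fin 3 → ℝ => torusExp s • (extChartAt (𝓡 7) x).symm y) =ᶠ[𝓝 0]
      ((extChartAt (𝓡 7) x).symm ∘ fun s : Fin 3 → ℝ => chartAction x (s, y)) := by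
    have hc : ContinuousAt (fun s : Fin 3 → ℝ => (s, y)) 0 := by fun_prop
    filter_upwards [hc.eventually (eventually_chartAction_mem hy)] with s hs
    exact ((extChartAt (𝓡 7) x).left_inv hs).symm
  have h3 := hasMFDerivAt_unique (h2.congr_of_eventuallyEq hev)
    (hasMFDerivAt_infAction ((extChartAt (𝓡 7) x).symm y))
  have h4 := DFunLike.congr_fun h3 v
  have h5 : ∀ z, z = y → ∀ X : R7, (paramDeriv x z : R7 → R7) X = (paramDeriv x y : R7 → R7) X := by
    rintro z rfl X; rfl
  exact (h5 _ (chartAction_zero hy) _).symm.trans h4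

/-- The differential of the torus action in a chart. -/
theorem paramDeriv_fderiv_chartAction {x : M} {y : R7} (hy : y ∈ (extChartAt (𝓡 7) x).target) :
    ∀ᶠ t : Fin 3 → ℝ in 𝓝 0, chartAction x (t, y) ∈ (extChartAt (𝓡 7) x).target ∧
      (extChartAt (𝓡 7) x).symm (chartAction x (t, y)) =
        torusExp t • (extChartAt (𝓡 7) x).symm y ∧
      ∀ a : R7, (paramDeriv x (chartAction x (t, y)) : R7 → R7)
        (fderiv ℝ (chartAction x) (t, y) (0, a)) =
        mfderiv (𝓡 7) (𝓡 7) (fun q : M => torusExp t • q) ((extChartAt (𝓡 7) x).symm y)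
          (paramDeriv x y a) := by
  have hd : ∀ᶠ p : (Fin 3 → ℝ) × R7 in 𝓝 (0, y), DifferentiableAt ℝ (chartAction x) p := by
    have := ((contDiffAt_chartAction hy).of_le (m := 1) (by simp)).eventually (by simp)
    filter_upwards [this] with p hp using hp.differentiableAt (by simp)
  have hc : ContinuousAt (fun s : Fin 3 → ℝ => (s, y)) 0 := by fun_prop
  filter_upwards [hc.eventually hd, hc.eventually (eventually_chartAction_mem hy).eventually_nhds]
    with t htd htm
  have hmem := htm.self_of_nhds
  have ht : chartAction x (t, y) ∈ (extChartAt (𝓡 7) x).target :=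
    (extChartAt (𝓡 7) x).map_source hmem
  refine ⟨ht, (extChartAt (𝓡 7) x).left_inv hmem, fun a => ?_⟩
  have h1 : HasFDerivAt (fun z : R7 => chartAction x (t, z))
      (fderiv ℝ (chartAction x) (t, y) ∘L .inr ℝ (Fin 3 → ℝ) R7) y :=
    HasFDerivAt.comp y (f := fun z : R7 => (t, z)) htd.hasFDerivAt (hasFDerivAt_prodMk_right _ _)
  have h2 := HasMFDerivAt.comp y (f := fun z : R7 => chartAction x (t, z))
    (hasMFDerivAt_paramDeriv ht) h1.hasMFDerivAt
  have h3 := HasMFDerivAt.comp y (hasMFDerivAt_smul_left (torusExp t) ((extChartAt (𝓡 7) x).symm y))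
    (hasMFDerivAt_paramDeriv hy)
  have hc' : ContinuousAt (fun z : R7 => (t, z)) y := by fun_prop
  have hev : ((fun q : M => torusExp t • q) ∘ (extChartAt (𝓡 7) x).symm) =ᶠ[𝓝 y]
      ((extChartAt (𝓡 7) x).symm ∘ fun z : R7 => chartAction x (t, z)) := by
    filter_upwards [hc'.eventually htm] with z hz
    exact ((extChartAt (𝓡 7) x).left_inv hz).symm
  exact DFunLike.congr_fun (hasMFDerivAt_unique (h2.congr_of_eventuallyEq hev) h3) a

theorem contDiffAt_chartGenerator {x : M} {y : R7} (hy : y ∈ (extChartAt (𝓡 7) x).target)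
    (v : Fin 3 → ℝ) : ContDiffAt ℝ ∞ (chartGenerator x v) y := by
  have h1 : ContDiffAt ℝ ∞ (fderiv ℝ (chartAction x)) ((0 : Fin 3 → ℝ), y) :=
    (contDiffAt_chartAction hy).fderiv_right (m := ∞) (by simp)
  have h2 : ContDiffAt ℝ ∞ (fun z : R7 => fderiv ℝ (chartAction x) (0, z)) y :=
    ContDiffAt.comp y (f := fun z : R7 => ((0 : Fin 3 → ℝ), z)) h1 (by fun_prop)
  exact h2.clm_apply contDiffAt_const

end Chart

open Filter Topology

theorem two_le_infty : (2 : WithTop ℕ∞) ≤ ∞ := WithTop.coe_le_coe.2 (le_top : (2 : ℕ∞) ≤ ⊤)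

/-! ### Consequences of the multi-moment maps -/

section Moment

variable {M : Type*} [TopologicalSpace M] [ChartedSpace R7 M] [MulAction Torus3 M]

theorem IsMultiMomentMap.contMDiff_apply {k : ℕ} {α : DiffForm M (k + 1)}
    {ν : M → (Fin 3 → ℝ) [⋀^Fin k]→L[ℝ] ℝ} (h : IsMultiMomentMap α ν) (v : Fin k → Fin 3 → ℝ) :
    ContMDiff (𝓡 7) 𝓘(ℝ, ℝ) ∞ fun q => ν q v :=
  ((ContinuousMultilinearMap.apply ℝ (fun _ : Fin k => Fin 3 → ℝ) ℝ v).comp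
    (ContinuousAlternatingMap.toContinuousMultilinearMapCLM ℝ)).contMDiff.comp h.smooth

/-- A moment map is constant along orbits, so its differential kills generators. For `φ` this says
that `φ` vanishes on any three of them, the last condition for a basic triple. -/
theorem IsMultiMomentMap.apply_infAction_eq_zero
    [ContMDiffSMul ((𝓡 1).prod ((𝓡 1).prod (𝓡 1))) (𝓡 7) ∞ Torus3 M]
    {k : ℕ} {α : DiffForm M (k + 1)}
    {ν : M → (Fin 3 → ℝ) [⋀^Fin k]→L[ℝ] ℝ} (h : IsMultiMomentMap α ν) (v : Fin k → Fin 3 → ℝ)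
    (p : M) (u : Fin 3 → ℝ) :
    α p (Fin.snoc (α := fun _ => TangentSpace (𝓡 7) p) (fun i => infAction p (v i))
      (infAction p u)) = 0 := by
  rw [← h.differential]
  have h0 : torusExp 0 • p = p := by rw [torusExp_zero, one_smul]
  have h1 := (((h.contMDiff_apply v).mdifferentiable (by simp)) (torusExp 0 • p)).hasMFDerivAt
  have h2 := HasMFDerivAt.comp (0 : Fin 3 → ℝ) h1 (hasMFDerivAt_infAction p)
  have h3 : ((fun q => ν q v) ∘ fun s : Fin 3 → ℝ => torusExp s • p) = fun _ => ν p v := by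
    ext s; exact congrFun (congrArg DFunLike.coe (h.invariant (torusExp s) p)) v
  rw [h3] at h2
  have h4 := DFunLike.congr_fun (hasMFDerivAt_unique h2 (hasMFDerivAt_const (ν p v) 0)) u
  have h6 : ∀ q : M, q = p → ∀ X : R7, (mfderiv (𝓡 7) 𝓘(ℝ, ℝ) (fun q => ν q v) q : R7 → ℝ) X =
      (mfderiv (𝓡 7) 𝓘(ℝ, ℝ) (fun q => ν q v) p : R7 → ℝ) X := by
    rintro q rfl X; rfl
  exact (h6 _ h0 _).symm.trans h4

end Moment

theorem G2Structure.form_apply {M : Type*} [TopologicalSpace M] [ChartedSpace R7 M]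
    (G : G2Structure M) (p : M) (X Y Z : TangentSpace (𝓡 7) p) :
    G.form p ![X, Y, Z] = phi0 ![G.frame p X, G.frame p Y, G.frame p Z] := by
  rw [G.form_eq]
  exact phi0_comp_apply _ _ _ _

theorem G2Structure.starForm_apply {M : Type*} [TopologicalSpace M] [ChartedSpace R7 M]
    (G : G2Structure M) (p : M) (X Y Z W : TangentSpace (𝓡 7) p) :
    G.starForm p ![X, Y, Z, W] =
      starPhi0 ![G.frame p X, G.frame p Y, G.frame p Z, G.frame p W] := by
  have h : ∀ v, G.starForm p v = starPhi0 fun i => G.frame p (v i) := fun v => by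
    rw [G2Structure.starForm, ContinuousAlternatingMap.compContinuousLinearMap_apply]
    rfl
  rw [h]
  congr 1; ext1 i; fin_cases i <;> rfl

section Moment

variable {M : Type*} [TopologicalSpace M] [ChartedSpace R7 M] [MulAction Torus3 M]
  {G : G2Structure M}

/-- The generators of the action given by `w` are orthonormal. -/
def G2Structure.IsOrthonormalAction (G : G2Structure M) (w : Fin 3 → Fin 3 → ℝ) : Prop :=
  ∀ (p : M) (i j : Fin 3), G.metric p (infAction p (w i)) (infAction p (w j)) =
    if i = j then 1 else 0

variable {w : Fin 3 → Fin 3 → ℝ}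

theorem G2Structure.IsOrthonormalAction.isBasicTriple
    [ContMDiffSMul ((𝓡 1).prod ((𝓡 1).prod (𝓡 1))) (𝓡 7) ∞ Torus3 M]
    (hw : G.IsOrthonormalAction w) (hm : IsMultiHamiltonian G.form) (p : M) :
    IsBasicTriple (G.frame p (infAction p (w 0))) (G.frame p (infAction p (w 1)))
      (G.frame p (infAction p (w 2))) where
  aa := hw p 0 0
  bb := hw p 1 1
  cc := hw p 2 2
  ab := hw p 0 1
  bc := hw p 1 2
  ca := hw p 2 0
  abc := by
    obtain ⟨ν, hν⟩ := hm
    rw [← phi0_eq_inner, ← G.form_apply]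
    have h := hν.apply_infAction_eq_zero ![w 0, w 1] p (w 2)
    rw [← h]
    congr 1
    ext1 i; fin_cases i <;> rfl

theorem G2Structure.IsOrthonormalAction.exists_potential
    [ContMDiffSMul ((𝓡 1).prod ((𝓡 1).prod (𝓡 1))) (𝓡 7) ∞ Torus3 M]
    (hw : G.IsOrthonormalAction w) (hm : IsMultiHamiltonian G.form)
    (hs : IsMultiHamiltonian G.starForm) (k : Fin 7) (hk : k.val < 4) :
    ∃ f : M → ℝ, ContMDiff (𝓡 7) 𝓘(ℝ, ℝ) ∞ f ∧
      ∀ p X, G.coframe w p X k = mfderiv (𝓡 7) 𝓘(ℝ, ℝ) f p X := by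
  have hb := hw.isBasicTriple hm
  obtain ⟨ν, hν⟩ := hm
  obtain ⟨μ, hμ⟩ := hs
  have h3 : ∀ (u v : Fin 3 → ℝ) (p : M) (X : TangentSpace (𝓡 7) p),
      mfderiv (𝓡 7) 𝓘(ℝ, ℝ) (fun q => ν q ![u, v]) p X =
        phi0 ![G.frame p (infAction p u), G.frame p (infAction p v), G.frame p X] := by
    intro u v p X
    rw [hν.differential, ← G.form_apply]
    congr 1; ext1 i; fin_cases i <;> rfl
  have h4 : ∀ (u v t : Fin 3 → ℝ) (p : M) (X : TangentSpace (𝓡 7) p),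
      mfderiv (𝓡 7) 𝓘(ℝ, ℝ) (fun q => μ q ![u, v, t]) p X =
        starPhi0 ![G.frame p (infAction p u), G.frame p (infAction p v),
          G.frame p (infAction p t), G.frame p X] := by
    intro u v t p X
    rw [hμ.differential, ← G.starForm_apply]
    congr 1; ext1 i; fin_cases i <;> rfl
  -- The vectors are listed in an odd order so that the swap absorbs the signs: components 0 to 2 of
  -- `adaptedMap` carry an explicit minus, and component 3 is minus the contraction of `*φ`.
  fin_cases k
  · refine ⟨_, hν.contMDiff_apply ![w 2, w 1], fun p X => ?_⟩
    rw [h3, phi0_swap, phi0_eq_inner]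
    rfl
  · refine ⟨_, hν.contMDiff_apply ![w 0, w 2], fun p X => ?_⟩
    rw [h3, phi0_swap, phi0_eq_inner]
    rfl
  · refine ⟨_, hν.contMDiff_apply ![w 1, w 0], fun p X => ?_⟩
    rw [h3, phi0_swap, phi0_eq_inner]
    rfl
  · refine ⟨_, hμ.contMDiff_apply ![w 1, w 0, w 2], fun p X => ?_⟩
    rw [h4, starPhi0_swap, (hb p).starPhi0_apply, neg_neg]
    rfl
  all_goals simp at hk

theorem G2Structure.coframe_infAction
    (hb : ∀ p, IsBasicTriple (G.frame p (infAction p (w 0))) (G.frame p (infAction p (w 1)))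
      (G.frame p (infAction p (w 2)))) (p : M) :
    G.coframe w p (infAction p (w 0)) = EuclideanSpace.single 4 1 ∧
    G.coframe w p (infAction p (w 1)) = EuclideanSpace.single 5 1 ∧
    G.coframe w p (infAction p (w 2)) = EuclideanSpace.single 6 1 := by
  have h := hb p
  have hinj : Function.Injective (basicMap (G.frame p (infAction p (w 0)))
      (G.frame p (infAction p (w 1))) (G.frame p (infAction p (w 2)))) := by
    rw [injective_iff_map_eq_zero]
    intro x hx
    have := h.inner_basicMap x x
    rw [hx, inner_zero_left] at this
    exact inner_self_eq_zero.1 this.symm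
  simp only [G.coframe_apply]
  refine ⟨?_, ?_, ?_⟩ <;> apply hinj <;> rw [h.basicMap_adaptedMap] <;> simp [basicMap_apply]

theorem G2Structure.inner_coframe
    (hb : ∀ p, IsBasicTriple (G.frame p (infAction p (w 0))) (G.frame p (infAction p (w 1)))
      (G.frame p (infAction p (w 2)))) (p : M) (X Y : TangentSpace (𝓡 7) p) :
    inner ℝ (G.coframe w p X) (G.coframe w p Y) = G.metric p X Y := by
  rw [G.coframe_apply, G.coframe_apply, (hb p).inner_adaptedMap]
  rfl

end Moment

/-! ### Smoothness and closedness of the adapted coframe -/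

section ChartCoframe

variable {M : Type*} [TopologicalSpace M] [ChartedSpace R7 M] [MulAction Torus3 M]
  {G : G2Structure M} {w : Fin 3 → Fin 3 → ℝ}

/-- The adapted coframe in a chart. -/
def G2Structure.chartCoframe (G : G2Structure M) (w : Fin 3 → Fin 3 → ℝ) (x : M) (y : R7) :
    R7 →L[ℝ] R7 :=
  G.coframe w ((extChartAt (𝓡 7) x).symm y) ∘L paramDeriv x y

theorem G2Structure.chartCoframe_apply (x : M) (y X : R7) :
    G.chartCoframe w x y X = G.coframe w ((extChartAt (𝓡 7) x).symm y) (paramDeriv x y X) := rfl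

theorem G2Structure.inChart_form_eq_coframe
    (hb : ∀ p, IsBasicTriple (G.frame p (infAction p (w 0))) (G.frame p (infAction p (w 1)))
      (G.frame p (infAction p (w 2)))) (x : M) :
    G.form.inChart x = fun y => phi0.compContinuousLinearMap (G.chartCoframe w x y) := by
  ext y v
  have hv : v = ![v 0, v 1, v 2] := by ext1 i; fin_cases i <;> rfl
  rw [G.inChart_form, hv, phi0_comp_apply, phi0_comp_apply]
  have h : ∀ X, G.chartCoframe w x y X = adaptedMap _ _ _ (G.chartFrame x y X) := fun X => rfl
  rw [h, h, h, (hb _).phi0_adaptedMap]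

theorem G2Structure.inChart_starForm_eq_coframe
    (hb : ∀ p, IsBasicTriple (G.frame p (infAction p (w 0))) (G.frame p (infAction p (w 1)))
      (G.frame p (infAction p (w 2)))) (x : M) :
    G.starForm.inChart x = fun y => starPhi0.compContinuousLinearMap (G.chartCoframe w x y) := by
  ext y v
  have hv : v = ![v 0, v 1, v 2, v 3] := by ext1 i; fin_cases i <;> rfl
  rw [G.inChart_starForm, hv, starPhi0_comp_apply, starPhi0_comp_apply]
  have h : ∀ X, G.chartCoframe w x y X = adaptedMap _ _ _ (G.chartFrame x y X) := fun X => rfl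
  rw [h, h, h, h, (hb _).starPhi0_adaptedMap]

theorem G2Structure.metricMatrix_eq_coframe
    (hb : ∀ p, IsBasicTriple (G.frame p (infAction p (w 0))) (G.frame p (infAction p (w 1)))
      (G.frame p (infAction p (w 2)))) (x : M) (y : R7) (i j : Fin 7) :
    metricMatrix G.metric x y i j = inner ℝ (G.chartCoframe w x y (EuclideanSpace.single i 1))
      (G.chartCoframe w x y (EuclideanSpace.single j 1)) :=
  (G.inner_coframe hb _ _ _).symm

variable [IsManifold (𝓡 7) ∞ M]

theorem G2Structure.exists_equiv_chartCoframe
    (hb : ∀ p, IsBasicTriple (G.frame p (infAction p (w 0))) (G.frame p (infAction p (w 1)))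
      (G.frame p (infAction p (w 2)))) {x : M} {y : R7}
    (hy : y ∈ (extChartAt (𝓡 7) x).target) :
    ∃ L : R7 ≃L[ℝ] R7, G.chartCoframe w x y = (L : R7 →L[ℝ] R7) := by
  have hinj : Function.Injective (G.chartCoframe w x y) := by
    rw [injective_iff_map_eq_zero]
    intro a ha
    have h := G.inner_coframe hb _ (paramDeriv x y a) (paramDeriv x y a)
    rw [← G.chartCoframe_apply, ha, inner_zero_left] at h
    have h2 := inner_self_eq_zero.1 h.symm
    rw [EmbeddingLike.map_eq_zero_iff] at h2
    exact injective_paramDeriv hy (h2.trans (map_zero (paramDeriv x y)).symm)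
  refine ⟨(LinearEquiv.ofInjectiveEndo (G.chartCoframe w x y).toLinearMap
    hinj).toContinuousLinearEquiv, ?_⟩
  ext1 X; rfl

variable [ContMDiffSMul ((𝓡 1).prod ((𝓡 1).prod (𝓡 1))) (𝓡 7) ∞ Torus3 M]

theorem G2Structure.IsOrthonormalAction.exists_chart_potential
    (hw : G.IsOrthonormalAction w) (hm : IsMultiHamiltonian G.form)
    (hs : IsMultiHamiltonian G.starForm) (x : M) (k : Fin 7) (hk : k.val < 4) :
    ∃ f : R7 → ℝ, ∀ y ∈ (extChartAt (𝓡 7) x).target, ContDiffAt ℝ ∞ f y ∧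
      ∀ X, G.chartCoframe w x y X k = fderiv ℝ f y X := by
  obtain ⟨f, hf, hd⟩ := hw.exists_potential hm hs k hk
  refine ⟨f ∘ (extChartAt (𝓡 7) x).symm, fun y hy => ⟨?_, fun X => ?_⟩⟩
  · exact (ContMDiffAt.comp y hf.contMDiffAt (contMDiffAt_chart_symm hy)).contDiffAt
  · rw [G.chartCoframe_apply, hd]
    have h := HasMFDerivAt.comp y ((hf.mdifferentiable (by simp)) _).hasMFDerivAt
      (hasMFDerivAt_paramDeriv hy)
    have h' := HasFDerivAt.fderiv (𝕜 := ℝ) (E := R7) (F := ℝ) (hasMFDerivAt_iff_hasFDerivAt.1 h)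
    exact (congrArg (fun L : R7 →L[ℝ] ℝ => L X) h').symm

/-- Components 4 to 6 are `g(U, ·)` for the three generators. Written through the chart generators
and the metric matrix they are visibly smooth. -/
theorem G2Structure.chartCoframe_orbit (x : M) {y : R7}
    (hy : y ∈ (extChartAt (𝓡 7) x).target) (X : R7) :
    G.chartCoframe w x y X 4 =
      ∑ i, ∑ j, chartGenerator x (w 0) y i * X j * metricMatrix G.metric x y i j ∧
    G.chartCoframe w x y X 5 =
      ∑ i, ∑ j, chartGenerator x (w 1) y i * X j * metricMatrix G.metric x y i j ∧
    G.chartCoframe w x y X 6 =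
      ∑ i, ∑ j, chartGenerator x (w 2) y i * X j * metricMatrix G.metric x y i j := by
  have h : ∀ v, G.chartFrame x y (chartGenerator x v y) = G.frame _ (infAction _ v) := fun v => by
    rw [← paramDeriv_chartGenerator hy]; rfl
  simp only [← G.inner_chartFrame, h]
  exact ⟨rfl, rfl, rfl⟩

/-- Smoothness cannot come from `G.frame`. It comes componentwise, from the potentials below index 4
and from `chartCoframe_orbit` above. -/
theorem G2Structure.IsOrthonormalAction.contDiffAt_chartCoframe
    (hw : G.IsOrthonormalAction w) (hm : IsMultiHamiltonian G.form)
    (hs : IsMultiHamiltonian G.starForm) (x : M) {y : R7}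
    (hy : y ∈ (extChartAt (𝓡 7) x).target) :
    ContDiffAt ℝ ∞ (G.chartCoframe w x) y := by
  refine ContDiffOn.contDiffAt (s := (extChartAt (𝓡 7) x).target) ?_
    ((isOpen_chart_target x).mem_nhds hy)
  refine contDiffOn_clm_apply.2 fun X y hy => ContDiffAt.contDiffWithinAt ?_
  have hn := (isOpen_chart_target x).mem_nhds hy
  rw [contDiffAt_piLp]
  intro k
  have h4 : ∀ v, ContDiffAt ℝ ∞ (fun z => ∑ i, ∑ j,
      chartGenerator x v z i * X j * metricMatrix G.metric x z i j) y := by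
    intro v
    refine ContDiffAt.sum fun i _ => ContDiffAt.sum fun j _ => ?_
    refine ContDiffAt.mul (ContDiffAt.mul ?_ contDiffAt_const) (G.contDiffAt_metricMatrix hy i j)
    exact (contDiffAt_piLp 2).1 (contDiffAt_chartGenerator hy v) i
  by_cases hk : k.val < 4
  · obtain ⟨f, hf⟩ := hw.exists_chart_potential hm hs x k hk
    have : ContDiffAt ℝ ∞ (fun z => fderiv ℝ f z X) y :=
      ((hf y hy).1.fderiv_right (m := ∞) (by simp)).clm_apply contDiffAt_const
    refine this.congr_of_eventuallyEq ?_
    filter_upwards [hn] with z hz using (hf z hz).2 X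
  · have h := fun z (hz : z ∈ (extChartAt (𝓡 7) x).target) =>
      G.chartCoframe_orbit (w := w) x hz X
    fin_cases k
    any_goals simp at hk
    · refine (h4 (w 0)).congr_of_eventuallyEq ?_
      filter_upwards [hn] with z hz using (h z hz).1
    · refine (h4 (w 1)).congr_of_eventuallyEq ?_
      filter_upwards [hn] with z hz using (h z hz).2.1
    · refine (h4 (w 2)).congr_of_eventuallyEq ?_
      filter_upwards [hn] with z hz using (h z hz).2.2

/-- The adapted coframe of a toric `G₂`-manifold with orthonormal generators is closed. -/
theorem G2Structure.IsOrthonormalAction.fderiv_chartCoframe_symm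
    (hw : G.IsOrthonormalAction w) (hT : G.IsTorsionFree) (hI : G.form.IsInvariant)
    (hm : IsMultiHamiltonian G.form)
    (hs : IsMultiHamiltonian G.starForm) (x : M) {y : R7}
    (hy : y ∈ (extChartAt (𝓡 7) x).target) (a b : R7) :
    fderiv ℝ (G.chartCoframe w x) y a b = fderiv ℝ (G.chartCoframe w x) y b a := by
  have hb := hw.isBasicTriple hm
  have hn := (isOpen_chart_target x).mem_nhds hy
  have hR : HasFDerivAt (G.chartCoframe w x) (fderiv ℝ (G.chartCoframe w x) y) y :=
    ((hw.contDiffAt_chartCoframe hm hs x hy).differentiableAt (by simp)).hasFDerivAt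
  obtain ⟨E, hE⟩ := G.exists_equiv_chartCoframe hb hy
  have hgen : ∀ z ∈ (extChartAt (𝓡 7) x).target,
      G.chartCoframe w x z (chartGenerator x (w 0) z) = EuclideanSpace.single 4 1 ∧
      G.chartCoframe w x z (chartGenerator x (w 1) z) = EuclideanSpace.single 5 1 ∧
      G.chartCoframe w x z (chartGenerator x (w 2) z) = EuclideanSpace.single 6 1 := by
    intro z hz
    simp only [G.chartCoframe_apply, paramDeriv_chartGenerator hz]
    exact G.coframe_infAction hb _
  -- The flow argument applies because the coframe is invariant and takes a constant value on each
  -- of the three generators.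
  have hflow : ∀ (v : Fin 3 → ℝ) (c : R7), (∀ z ∈ (extChartAt (𝓡 7) x).target,
      G.chartCoframe w x z (chartGenerator x v z) = c) → ∀ a,
      fderiv ℝ (G.chartCoframe w x) y (E.symm c) a =
        fderiv ℝ (G.chartCoframe w x) y a (E.symm c) := by
    intro v c hc a
    have hEc : E.symm c = fderiv ℝ (chartAction x) (0, y) (v, 0) := by
      rw [ContinuousLinearEquiv.symm_apply_eq, ← hc y hy, hE]
      rfl
    rw [hEc]
    refine fderiv_apply_generator_comm ((contDiffAt_chartAction hy).of_le two_le_infty) ?_ hR v ?_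
      (c := c) ?_ a
    · filter_upwards [hn] with z hz using chartAction_zero hz
    · filter_upwards [paramDeriv_fderiv_chartAction hy] with t ht a
      obtain ⟨h1, h2, h3⟩ := ht
      have h4 := G.coframe_smul hI w (torusExp t) ((extChartAt (𝓡 7) x).symm y) (paramDeriv x y a)
      rw [G.chartCoframe_apply, G.chartCoframe_apply, ← h4]
      have h5 : ∀ q q' : M, q = q' → ∀ X X' : R7, X = X' → (G.coframe w q : R7 → R7) X =
        (G.coframe w q' : R7 → R7) X' := by rintro q _ rfl X _ rfl; rfl
      exact h5 _ _ h2 _ _ (h3 a)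
    · filter_upwards [hn] with z hz using hc z hz
  refine torsion_eq_zero hR E hE ?_ ?_ ?_ ?_ a b
  · intro k hk a b
    obtain ⟨f, hf⟩ := hw.exists_chart_potential hm hs x k hk
    have hff : ContDiffAt ℝ 2 f y := (hf y hy).1.of_le two_le_infty
    have h2 : ∀ a b, (fderiv ℝ (G.chartCoframe w x) y a b) k = fderiv ℝ (fderiv ℝ f) y a b := by
      intro a b
      have e1 := (EuclideanSpace.proj k : R7 →L[ℝ] ℝ).hasFDerivAt.comp y
        (hR.clm_apply (hasFDerivAt_const b y))
      have e2 := (((hff.fderiv_right (m := 1) (by norm_num)).differentiableAt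
        (by norm_num)).hasFDerivAt).clm_apply (hasFDerivAt_const b y)
      have e3 := e2.congr_of_eventuallyEq
        (f₁ := (EuclideanSpace.proj k : R7 →L[ℝ] ℝ) ∘ fun z => G.chartCoframe w x z b)
        (by filter_upwards [hn] with z hz using (hf z hz).2 b)
      simpa using DFunLike.congr_fun (e1.unique e3) a
    rw [h2, h2]
    exact (hff.isSymmSndFDerivAt (by simp)) a b
  · intro i hi a
    fin_cases i
    any_goals simp at hi
    · exact hflow (w 0) _ (fun z hz => (hgen z hz).1) a
    · exact hflow (w 1) _ (fun z hz => (hgen z hz).2.1) a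
    · exact hflow (w 2) _ (fun z hz => (hgen z hz).2.2) a
  · rw [← G.inChart_form_eq_coframe hb]
    exact hT.1 x y hy
  · rw [← G.inChart_starForm_eq_coframe hb]
    exact hT.2 x y hy

end ChartCoframe

/-! ### Torsion elements in one-parameter subgroups of the torus -/

/-- The half-period of `torusExp` indexed by a set of coordinates. -/
def halfPeriod (b : Fin 3 → Bool) : Fin 3 → ℝ := fun i => if b i then Real.pi else 0

theorem torusExp_halfPeriod_ne_one {b : Fin 3 → Bool} (hb : ∃ i, b i = true) :
    torusExp (halfPeriod b) ≠ 1 := by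
  obtain ⟨i, hi⟩ := hb
  intro h
  simp only [torusExp, Prod.ext_iff, Prod.fst_one, Prod.snd_one] at h
  obtain ⟨h0, h1, h2⟩ := h
  fin_cases i <;> simp only [halfPeriod] at hi h0 h1 h2
  · exact Circle.exp_pi_ne_one ((congrArg Circle.exp (if_pos hi)).symm.trans h0)
  · exact Circle.exp_pi_ne_one ((congrArg Circle.exp (if_pos hi)).symm.trans h1)
  · exact Circle.exp_pi_ne_one ((congrArg Circle.exp (if_pos hi)).symm.trans h2)

theorem torusExp_int_mul_two_pi (m : Fin 3 → ℤ) :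
    torusExp (fun i => m i * (2 * Real.pi)) = 1 := by
  simp only [torusExp, Circle.exp_int_mul_two_pi]
  rfl

theorem torusExp_halfPeriod_mul_self (b : Fin 3 → Bool) :
    torusExp (halfPeriod b) * torusExp (halfPeriod b) = 1 := by
  rw [← torusExp_add, ← torusExp_int_mul_two_pi fun i => if b i then 1 else 0]
  congr 1; ext i
  by_cases h : b i <;> simp [halfPeriod, h]
  ring

theorem torusExp_int_mul_pi_add (m : Fin 3 → ℤ) (e : Fin 3 → ℝ) :
    torusExp (fun i => m i * Real.pi + e i) =
      torusExp (halfPeriod (fun i => decide (Odd (m i))) + e) := by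
  have h : (fun i => m i * Real.pi + e i) = (fun i => (m i / 2 : ℤ) * (2 * Real.pi)) +
      (halfPeriod (fun i => decide (Odd (m i))) + e) := by
    ext i
    simp only [Pi.add_apply, halfPeriod, decide_eq_true_eq]
    split_ifs with ho
    · obtain ⟨k, hk⟩ := ho
      have : m i / 2 = k := by omega
      rw [this, hk]; push_cast; ring
    · obtain ⟨k, hk⟩ := Int.not_odd_iff_even.1 ho
      have : m i / 2 = k := by omega
      rw [this, hk]; push_cast; ring
  rw [h, torusExp_add, torusExp_int_mul_two_pi, one_mul]

/-- Simultaneous Diophantine approximation by compactness: two multiples of `a` have nearby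
fractional parts, and their difference is the wanted multiple. -/
theorem exists_int_near_nat_smul (a : Fin 3 → ℝ) {ε : ℝ} (hε : 0 < ε) :
    ∃ n : ℕ, 0 < n ∧ ∃ m : Fin 3 → ℤ, ‖(fun i => n * a i - m i : Fin 3 → ℝ)‖ < ε := by
  have hK : IsCompact (Set.univ.pi fun _ : Fin 3 => Set.Icc (0 : ℝ) 1) :=
    isCompact_univ_pi fun _ => isCompact_Icc
  obtain ⟨x, -, φ, hφ, hx⟩ := hK.tendsto_subseq
    (x := fun n : ℕ => fun i => Int.fract (n * a i)) fun n i _ =>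
      ⟨Int.fract_nonneg _, (Int.fract_lt_one _).le⟩
  obtain ⟨N, hN⟩ := Metric.cauchySeq_iff'.1 hx.cauchySeq ε hε
  refine ⟨φ (N + 1) - φ N, Nat.sub_pos_of_lt (hφ (Nat.lt_succ_self N)),
    fun i => ⌊φ (N + 1) * a i⌋ - ⌊φ N * a i⌋, ?_⟩
  have h := hN (N + 1) (Nat.le_succ N)
  rw [dist_eq_norm] at h
  refine lt_of_eq_of_lt (congrArg norm ?_) h
  ext i
  rw [Nat.cast_sub (hφ (Nat.lt_succ_self N)).le]
  simp only [Function.comp, Pi.sub_apply, Int.fract]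
  push_cast; ring

theorem exists_pow_two_smul_odd {m : Fin 3 → ℤ} (hm : m ≠ 0) :
    ∃ (k : ℕ) (m' : Fin 3 → ℤ), (∀ i, m i = 2 ^ k * m' i) ∧ ∃ i, Odd (m' i) := by
  classical
  have hex : ∃ k : ℕ, ¬ ∀ i, (2 ^ k : ℤ) ∣ m i := by
    obtain ⟨i, hi⟩ := Function.ne_iff.1 hm
    refine ⟨(m i).natAbs, fun h => ?_⟩
    have h1 := Int.natAbs_dvd_natAbs.2 (h i)
    have h2 := Nat.le_of_dvd (Int.natAbs_pos.2 hi) h1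
    rw [Int.natAbs_pow] at h2
    exact absurd h2 (not_le.2 Nat.lt_two_pow_self)
  obtain ⟨k, hk⟩ : ∃ k, Nat.find hex = k + 1 := by
    refine Nat.exists_eq_succ_of_ne_zero fun h => ?_
    have := Nat.find_spec hex
    rw [h] at this
    simp at this
  have h1 : ∀ i, (2 ^ k : ℤ) ∣ m i := by
    have := Nat.find_min hex (m := k) (by omega)
    simpa using this
  choose m' hm' using h1
  refine ⟨k, m', hm', ?_⟩
  by_contra! h
  refine Nat.find_spec hex fun i => ?_
  rw [hk, hm' i, pow_succ]
  exact mul_dvd_mul_left _ (Int.not_odd_iff_even.1 (h i)).two_dvd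

/-- A multiple of `v` lies near a nonzero vector `2π m` of the period lattice. Writing `m = 2 ^ k
m'` with some entry of `m'` odd and dividing by `2 ^ (k + 1)` gives a point of the line near `π m'`,
which is a nonzero half-period modulo periods. As `K` is closed and there are finitely many
half-periods, one of them lies in `K`. -/
theorem exists_halfPeriod_mem_of_isClosed {K : Set (Fin 3 → ℝ)} (hK : IsClosed K)
    (hper : ∀ s t, torusExp s = torusExp t → s ∈ K → t ∈ K)
    {v : Fin 3 → ℝ} (hv : v ≠ 0) (hvK : ∀ s : ℝ, s • v ∈ K) :
    ∃ b : Fin 3 → Bool, (∃ i, b i = true) ∧ halfPeriod b ∈ K := by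
  by_contra! hne
  have hev : ∀ᶠ e : Fin 3 → ℝ in 𝓝 0, ∀ b : Fin 3 → Bool, (∃ i, b i = true) →
      halfPeriod b + e ∉ K := by
    rw [eventually_all]
    intro b
    by_cases hb : ∃ i, b i = true
    · have hc : ContinuousAt (fun e : Fin 3 → ℝ => halfPeriod b + e) 0 := by fun_prop
      have h0 : halfPeriod b + 0 ∈ Kᶜ := by rw [add_zero]; exact hne b hb
      filter_upwards [hc.eventually (hK.isOpen_compl.mem_nhds h0)] with e he _ using he
    · exact Eventually.of_forall fun e h => absurd h hb
  obtain ⟨ε, hε, hball⟩ := Metric.eventually_nhds_iff.1 hev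
  have hπ := Real.pi_pos
  set a : Fin 3 → ℝ := fun i => v i / (2 * Real.pi) with ha
  have ha0 : a ≠ 0 := by
    obtain ⟨i, hi⟩ := Function.ne_iff.1 hv
    exact Function.ne_iff.2 ⟨i, div_ne_zero hi (by positivity)⟩
  -- The bound `‖a‖` forces `m ≠ 0`, since otherwise `n ‖a‖ < ‖a‖`; the other bound keeps the final
  -- error below `ε`.
  have hδ : 0 < min ‖a‖ (ε / (2 * Real.pi)) := lt_min (norm_pos_iff.2 ha0) (by positivity)
  obtain ⟨n, hn, m, hm⟩ := exists_int_near_nat_smul a hδ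
  have hm0 : m ≠ 0 := by
    rintro rfl
    have h1 : (fun i => n * a i - (0 : Fin 3 → ℤ) i : Fin 3 → ℝ) = (n : ℝ) • a := by ext i; simp
    rw [h1, norm_smul, RCLike.norm_natCast] at hm
    have h2 := hm.trans_le (min_le_left _ _)
    have h3 : (1 : ℝ) ≤ n := by exact_mod_cast hn
    nlinarith [norm_nonneg a]
  obtain ⟨k, m', hm', hodd⟩ := exists_pow_two_smul_odd hm0
  set e : Fin 3 → ℝ := fun i => (n * a i - m i) * (2 * Real.pi) / 2 ^ (k + 1) with he
  have hek : ‖e‖ < ε := by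
    have h1 : e = (2 * Real.pi / 2 ^ (k + 1)) • fun i => n * a i - m i := by
      ext i; simp only [he, Pi.smul_apply, smul_eq_mul]; ring
    rw [h1, norm_smul, Real.norm_of_nonneg (by positivity)]
    have h2 := hm.trans_le (min_le_right _ _)
    have h3 : (1 : ℝ) ≤ 2 ^ (k + 1) := one_le_pow₀ (by norm_num)
    calc 2 * Real.pi / 2 ^ (k + 1) * ‖(fun i => n * a i - m i : Fin 3 → ℝ)‖
        ≤ 2 * Real.pi * ‖(fun i => n * a i - m i : Fin 3 → ℝ)‖ := by
          gcongr; exact div_le_self (by positivity) h3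
      _ < 2 * Real.pi * (ε / (2 * Real.pi)) := by gcongr
      _ = ε := by field_simp
  refine hball (y := e) (by rwa [dist_zero_right]) (fun i => decide (Odd (m' i))) ?_ ?_
  · obtain ⟨i, hi⟩ := hodd
    exact ⟨i, by simpa using hi⟩
  · refine hper _ _ ?_ (hvK (n / 2 ^ (k + 1)))
    rw [← torusExp_int_mul_pi_add]
    congr 1; ext i
    simp only [he, ha, hm', Pi.smul_apply, smul_eq_mul]
    push_cast
    field_simp
    ring

/-! ### Points with non-injective infinitesimal action -/

section Fixed

variable {M : Type*} [TopologicalSpace M] [ChartedSpace R7 M] [MulAction Torus3 M]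
  [ContMDiffSMul ((𝓡 1).prod ((𝓡 1).prod (𝓡 1))) (𝓡 7) ∞ Torus3 M]

theorem hasMFDerivAt_torusExp_smul (p : M) (t : Fin 3 → ℝ) :
    HasMFDerivAt 𝓘(ℝ, Fin 3 → ℝ) (𝓡 7) (fun t : Fin 3 → ℝ => torusExp t • p) t
      (mfderiv (𝓡 7) (𝓡 7) (fun q : M => torusExp t • q) p ∘L infAction p) := by
  have h0 : ∀ z : Fin 3 → ℝ, z = 0 → HasMFDerivAt 𝓘(ℝ, Fin 3 → ℝ) (𝓡 7)
      (fun t : Fin 3 → ℝ => torusExp t • p) z (infAction p : (Fin 3 → ℝ) →L[ℝ] R7) := by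
    rintro _ rfl; exact hasMFDerivAt_infAction p
  have h1 : HasMFDerivAt 𝓘(ℝ, Fin 3 → ℝ) 𝓘(ℝ, Fin 3 → ℝ) (fun s : Fin 3 → ℝ => s - t) t
      (ContinuousLinearMap.id ℝ (Fin 3 → ℝ)) :=
    ((hasFDerivAt_id t).sub_const t).hasMFDerivAt
  have h2 := HasMFDerivAt.comp t (f := fun s : Fin 3 → ℝ => s - t) (h0 (t - t) (sub_self t)) h1
  have h3 : ∀ z : M, z = p → HasMFDerivAt (𝓡 7) (𝓡 7) (fun q : M => torusExp t • q) z
      (mfderiv (𝓡 7) (𝓡 7) (fun q : M => torusExp t • q) p : R7 →L[ℝ] R7) := by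
    rintro _ rfl; exact hasMFDerivAt_smul_left _ _
  have h4 := HasMFDerivAt.comp t (h3 (torusExp (t - t) • p) (by
    rw [sub_self, torusExp_zero, one_smul])) h2
  refine h4.congr_of_eventuallyEq (Eventually.of_forall fun s => ?_)
  simp only [Function.comp, smul_smul, ← torusExp_add, add_sub_cancel]

/-- The velocity of the orbit at any time is the translate of `infAction p v = 0`. The orbit is thus
an integral curve of the zero field, and so is the constant curve; uniqueness identifies them. -/
theorem torusExp_smul_smul_eq_self [T2Space M] [IsManifold (𝓡 7) ∞ M] {p : M} {v : Fin 3 → ℝ}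
    (h : infAction p v = 0) (s : ℝ) : torusExp (s • v) • p = p := by
  have : IsManifold (𝓡 7) 1 M := IsManifold.of_le (n := ∞) (by simp)
  have hγ : IsMIntegralCurve (I := 𝓡 7) (fun s : ℝ => torusExp (s • v) • p)
      (fun q => (0 : TangentSpace (𝓡 7) q)) := by
    intro s
    have h1 : HasMFDerivAt 𝓘(ℝ, ℝ) 𝓘(ℝ, Fin 3 → ℝ) (fun s : ℝ => s • v) s
      (ContinuousLinearMap.toSpanSingleton ℝ v) :=
      ((ContinuousLinearMap.toSpanSingleton ℝ v).hasFDerivAt (x := s)).hasMFDerivAt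
    have h2 := HasMFDerivAt.comp s (hasMFDerivAt_torusExp_smul p (s • v)) h1
    refine h2.congr_mfderiv (ContinuousLinearMap.ext fun (c : ℝ) => ?_)
    change mfderiv (𝓡 7) (𝓡 7) (fun q : M => torusExp (s • v) • q) p (infAction p (c • v)) =
      c • (0 : R7)
    rw [map_smul, h, smul_zero, smul_zero]
    exact map_zero _
  have hγ' : IsMIntegralCurve (I := 𝓡 7) (fun _ : ℝ => p)
      (fun q => (0 : TangentSpace (𝓡 7) q)) := by
    intro s
    refine (hasMFDerivAt_const p s).congr_mfderiv (ContinuousLinearMap.ext fun (c : ℝ) => ?_)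
    exact (smul_zero c : c • (0 : R7) = 0).symm
  have := isMIntegralCurve_Ioo_eq_of_contMDiff_boundaryless (I := 𝓡 7) (t₀ := 0)
    (v := fun q : M => (0 : TangentSpace (𝓡 7) q))
    (Bundle.contMDiff_zeroSection ℝ (TangentSpace (𝓡 7) : M → Type _)) hγ hγ'
    (by simp [torusExp_zero])
  exact congrFun this s

theorem exists_halfPeriod_smul_eq_self [T2Space M] [IsManifold (𝓡 7) ∞ M] {p : M}
    (h : ¬ Function.Injective (infAction p)) :
    ∃ b : Fin 3 → Bool, (∃ i, b i = true) ∧ torusExp (halfPeriod b) • p = p := by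
  rw [injective_iff_map_eq_zero] at h
  push Not at h
  obtain ⟨v, hv, hv0⟩ := h
  refine exists_halfPeriod_mem_of_isClosed (K := {t | torusExp t • p = p}) ?_ ?_ hv0
    fun s => torusExp_smul_smul_eq_self hv s
  · exact isClosed_eq (contMDiff_torusExp_smul p).continuous continuous_const
  · intro s t hst hs
    simpa only [Set.mem_ofPred_eq, ← hst] using hs

end Fixed

/-! ### Involutions with interior fixed points -/

section Involution

variable {M : Type*} [TopologicalSpace M] [T2Space M] [ChartedSpace R7 M] [IsManifold (𝓡 7) ∞ M]

/-- By continuity `dσ` is the identity at `p`. In a chart `x` the average `x + x ∘ σ` then has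
derivative `2` and is locally injective; being `σ`-invariant, it forces `σ q = q` near `p`. -/
theorem ContMDiff.mem_interior_fixed_of_mem_closure {σ : M → M} (hσ : ContMDiff (𝓡 7) (𝓡 7) ∞ σ)
    (hinv : ∀ q, σ (σ q) = q) {p : M} (hp : p ∈ closure (interior {q | σ q = q})) :
    p ∈ interior {q | σ q = q} := by
  have hcl : IsClosed {q | σ q = q} := isClosed_eq hσ.continuous continuous_id
  have hpp : σ p = p := closure_minimal interior_subset hcl hp
  set x := extChartAt (𝓡 7) p with hx
  have hps : p ∈ x.source := mem_extChartAt_source p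
  have hyt : x p ∈ x.target := x.map_source hps
  set f : R7 → R7 := fun y => x (σ (x.symm y)) with hf
  have hxsp : x.symm (x p) = p := x.left_inv hps
  have hfs : ContDiffAt ℝ 1 f (x p) := by
    refine ContDiffAt.of_le (n := ∞) (ContMDiffAt.contDiffAt ?_) (by simp)
    refine ContMDiffAt.comp (x p) (g := x) (I' := 𝓡 7) (f := fun y => σ (x.symm y)) ?_ ?_
    · rw [hxsp, hpp]; exact contMDiffAt_chart hps
    · exact ContMDiffAt.comp (x p) hσ.contMDiffAt (contMDiffAt_chart_symm hyt)
  have hcx : ContinuousAt x p := (contMDiffAt_chart hps).continuousAt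
  have hfd : fderiv ℝ f (x p) = ContinuousLinearMap.id ℝ R7 := by
    have ht : Tendsto (fderiv ℝ f) (𝓝 (x p)) (𝓝 (fderiv ℝ f (x p))) :=
      (hfs.fderiv_right (m := 0) (by simp)).continuousAt
    have hfr : ∃ᶠ q in 𝓝 p, fderiv ℝ f (x q) ∈ ({ContinuousLinearMap.id ℝ R7} : Set _) := by
      refine ((mem_closure_iff_frequently.1 hp).and_eventually
        ((isOpen_extChartAt_source p).mem_nhds hps)).mono ?_
      rintro q ⟨hq, hqs⟩
      have hyq : x q ∈ x.target := x.map_source hqs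
      have hcs : ContinuousAt x.symm (x q) := (contMDiffAt_chart_symm hyq).continuousAt
      have hnq : interior {q | σ q = q} ∈ 𝓝 (x.symm (x q)) := by
        rw [x.left_inv hqs]; exact isOpen_interior.mem_nhds hq
      have : f =ᶠ[𝓝 (x q)] id := by
        filter_upwards [hcs hnq, (isOpen_chart_target p).mem_nhds hyq] with z hz hzt
        have h1 : x.symm z ∈ {q | σ q = q} := interior_subset hz
        rw [Set.mem_ofPred_eq] at h1
        simp only [hf, h1, id]
        exact x.right_inv hzt
      rw [Set.mem_singleton_iff, this.fderiv_eq, fderiv_id]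
    exact isClosed_singleton.mem_of_frequently_of_tendsto hfr (ht.comp hcx)
  have hF : HasStrictFDerivAt (fun y => y + f y)
      ((ContinuousLinearEquiv.smulLeft (Units.mk0 (2 : ℝ) two_ne_zero) : R7 ≃L[ℝ] R7) :
        R7 →L[ℝ] R7) (x p) := by
    have h := (hasStrictFDerivAt_id (𝕜 := ℝ) (x p)).add (hfs.hasStrictFDerivAt (by simp))
    rw [hfd] at h
    refine h.congr_fderiv (ContinuousLinearMap.ext fun X => ?_)
    exact (two_smul ℝ X).symm
  set Φ := hF.toOpenPartialHomeomorph
  have hΦ : Φ.source ∈ 𝓝 (x p) := Φ.open_source.mem_nhds hF.mem_toOpenPartialHomeomorph_source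
  have hcσ : ContinuousAt σ p := hσ.continuous.continuousAt
  have hcxσ : ContinuousAt (fun q => x (σ q)) p :=
    ContinuousAt.comp (g := x) (f := σ) (by rwa [hpp]) hcσ
  rw [mem_interior_iff_mem_nhds]
  filter_upwards [hcx hΦ, hcxσ (by simpa only [hpp] using hΦ), (isOpen_extChartAt_source p).mem_nhds hps,
    hcσ (by rw [hpp]; exact (isOpen_extChartAt_source p).mem_nhds hps)] with q h1 h2 h3 h4
  refine x.injOn h4 h3 (Φ.injOn h2 h1 ?_)
  change x (σ q) + x (σ (x.symm (x (σ q)))) = x q + x (σ (x.symm (x q)))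
  rw [x.left_inv h4, x.left_inv h3, hinv, add_comm]

theorem ContMDiff.eq_self_of_interior_fixed_nonempty [ConnectedSpace M] {σ : M → M}
    (hσ : ContMDiff (𝓡 7) (𝓡 7) ∞ σ) (hinv : ∀ q, σ (σ q) = q)
    (hU : (interior {q | σ q = q}).Nonempty) (q : M) : σ q = q := by
  have hc : IsClopen (interior {q | σ q = q}) :=
    ⟨closure_subset_iff_isClosed.1 fun p hp => hσ.mem_interior_fixed_of_mem_closure hinv hp,
      isOpen_interior⟩
  have : q ∈ interior {q | σ q = q} := by rw [hc.eq_univ hU]; trivial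
  exact (interior_subset this : q ∈ {q | σ q = q})

end Involution

/-- Otherwise the finitely many closed fixed sets of the torus involutions cover `M`, and Baire
gives one of them interior. Connectedness makes that involution act trivially, contradicting
effectiveness. -/
theorem regularSet_nonempty {M : Type*} [TopologicalSpace M] [T2Space M] [ConnectedSpace M]
    [ChartedSpace R7 M] [IsManifold (𝓡 7) ∞ M] [MulAction Torus3 M]
    [ContMDiffSMul ((𝓡 1).prod ((𝓡 1).prod (𝓡 1))) (𝓡 7) ∞ Torus3 M] [FaithfulSMul Torus3 M] :
    (regularSet M).Nonempty := by
  by_contra hne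
  rw [Set.not_nonempty_iff_eq_empty] at hne
  have hp : ∀ p : M, ¬ Function.Injective (infAction p) := fun p h => by
    have : p ∈ regularSet M := h
    rw [hne] at this; exact this
  have := ChartedSpace.locallyCompactSpace R7 M
  obtain ⟨⟨b, hb⟩, hint⟩ := nonempty_interior_of_iUnion_of_closed
    (ι := {b : Fin 3 → Bool // ∃ i, b i = true})
    (f := fun b => {q : M | torusExp (halfPeriod b.1) • q = q})
    (fun b => isClosed_eq (contMDiff_smul_left _).continuous continuous_id) (by
      refine Set.eq_univ_of_forall fun p => ?_
      obtain ⟨b, hb, h⟩ := exists_halfPeriod_smul_eq_self (hp p)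
      exact Set.mem_iUnion.2 ⟨⟨b, hb⟩, h⟩)
  refine torusExp_halfPeriod_ne_one hb (FaithfulSMul.eq_of_smul_eq_smul (α := M) fun q => ?_)
  rw [one_smul]
  refine (contMDiff_smul_left _).eq_self_of_interior_fixed_nonempty (fun q => ?_) hint q
  rw [smul_smul, torusExp_halfPeriod_mul_self, one_smul]

/-! ### Coordinates with prescribed closed coframe -/

/-- On a ball the closed `E`-valued one-form `R` has a primitive by the Poincaré lemma. Its
derivative `R` is invertible, so the inverse function theorem makes it a local diffeomorphism. -/
theorem exists_openPartialHomeomorph_of_fderiv_symmetric {E : Type*} [NormedAddCommGroup E]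
    [NormedSpace ℝ E] [CompleteSpace E] {Ω : Set E} (hΩ : IsOpen Ω) {R : E → E →L[ℝ] E}
    (hR : ContDiffOn ℝ ∞ R Ω) (hsymm : ∀ z ∈ Ω, ∀ a b, fderiv ℝ R z a b = fderiv ℝ R z b a)
    (hE : ∀ z ∈ Ω, ∃ L : E ≃L[ℝ] E, R z = (L : E →L[ℝ] E)) {y : E} (hy : y ∈ Ω) :
    ∃ Ψ : OpenPartialHomeomorph E E, y ∈ Ψ.source ∧ Ψ.source ⊆ Ω ∧
      (∀ z ∈ Ψ.source, HasFDerivAt Ψ (R z) z) ∧ ContDiffOn ℝ ∞ Ψ Ψ.source ∧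
      ContDiffOn ℝ ∞ Ψ.symm Ψ.target := by
  obtain ⟨r, hr, hball⟩ := Metric.isOpen_iff.1 hΩ y hy
  have hyB : y ∈ Metric.ball y r := Metric.mem_ball_self hr
  obtain ⟨Φ, hΦ⟩ := (convex_ball y r).exists_forall_hasFDerivAt_of_fderiv_symmetric
    Metric.isOpen_ball ((hR.mono hball).differentiableOn (by simp))
    fun z hz => hsymm z (hball hz)
  have hΦs : ContDiffOn ℝ ∞ Φ (Metric.ball y r) := by
    rw [contDiffOn_infty_iff_fderiv_of_isOpen Metric.isOpen_ball]
    refine ⟨fun z hz => (hΦ z hz).differentiableAt.differentiableWithinAt, ?_⟩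
    exact (hR.mono hball).congr fun z hz => (hΦ z hz).fderiv
  have hat : ∀ z ∈ Metric.ball y r, ContDiffAt ℝ ∞ Φ z := fun z hz =>
    hΦs.contDiffAt (Metric.isOpen_ball.mem_nhds hz)
  obtain ⟨L, hL⟩ := hE y hy
  have hΦL : HasFDerivAt Φ (L : E →L[ℝ] E) y := by rw [← hL]; exact hΦ y hyB
  set Ψ := ((hat y hyB).toOpenPartialHomeomorph Φ hΦL (by simp)).restrOpen (Metric.ball y r)
    Metric.isOpen_ball
  have hΨ : ∀ z, Ψ z = Φ z := fun z => rfl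
  have hsub : ∀ z ∈ Ψ.source, z ∈ Metric.ball y r := fun z hz => hz.2
  refine ⟨Ψ, ⟨(hat y hyB).mem_toOpenPartialHomeomorph_source hΦL (by simp), hyB⟩,
    fun z hz => hball (hsub z hz), fun z hz => hΦ z (hsub z hz),
    fun z hz => (hat z (hsub z hz)).contDiffWithinAt, fun a ha => ?_⟩
  have hz := hsub _ (Ψ.map_target ha)
  obtain ⟨L', hL'⟩ := hE _ (hball hz)
  refine (Ψ.contDiffAt_symm ha (f₀' := L') ?_ (hat _ hz)).contDiffWithinAt
  rw [← hL']
  exact hΦ _ hz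

/-! ### Flatness and isometric coordinates for orthonormal generators -/

section Isometry

variable {M : Type*} [TopologicalSpace M] [ChartedSpace R7 M] [MulAction Torus3 M]
  [IsManifold (𝓡 7) ∞ M] [ContMDiffSMul ((𝓡 1).prod ((𝓡 1).prod (𝓡 1))) (𝓡 7) ∞ Torus3 M]
  {G : G2Structure M} {w : Fin 3 → Fin 3 → ℝ}

theorem G2Structure.IsOrthonormalAction.contDiffOn_chartCoframe
    (hw : G.IsOrthonormalAction w) (hm : IsMultiHamiltonian G.form)
    (hs : IsMultiHamiltonian G.starForm) (x : M) :
    ContDiffOn ℝ ∞ (G.chartCoframe w x) (extChartAt (𝓡 7) x).target := fun _ hy =>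
  (hw.contDiffAt_chartCoframe hm hs x hy).contDiffWithinAt

theorem G2Structure.IsOrthonormalAction.isFlat
    (hw : G.IsOrthonormalAction w) (hT : G.IsTorsionFree) (hI : G.form.IsInvariant)
    (hm : IsMultiHamiltonian G.form) (hs : IsMultiHamiltonian G.starForm) : IsFlat G.metric := by
  have hb := hw.isBasicTriple hm
  intro x y hy l i j k
  refine riemannCurvature_of_closed_coframe (isOpen_chart_target x)
    ((hw.contDiffOn_chartCoframe hm hs x).of_le two_le_infty)
    (fun z _ i j => G.metricMatrix_eq_coframe hb x z i j) (fun z hz => ?_)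
    (fun z hz a b => hw.fderiv_chartCoframe_symm hT hI hm hs x hz a b) hy l i j k
  obtain ⟨L, hL⟩ := G.exists_equiv_chartCoframe hb hz
  rw [hL]
  exact ⟨ContinuousLinearEquiv.toUnit L, rfl⟩

theorem G2Structure.IsOrthonormalAction.isLocallyIsometricToR7
    (hw : G.IsOrthonormalAction w) (hT : G.IsTorsionFree) (hI : G.form.IsInvariant)
    (hm : IsMultiHamiltonian G.form) (hs : IsMultiHamiltonian G.starForm) :
    IsLocallyIsometricToR7 G.metric := by
  have hb := hw.isBasicTriple hm
  intro p
  set x := extChartAt (𝓡 7) p with hx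
  have hps : p ∈ x.source := mem_extChartAt_source p
  obtain ⟨Ψ, hpΨ, hsub, hd, hΨ, hΨs⟩ := exists_openPartialHomeomorph_of_fderiv_symmetric
    (isOpen_chart_target p) (hw.contDiffOn_chartCoframe hm hs p)
    (fun z hz a b => hw.fderiv_chartCoframe_symm hT hI hm hs p hz a b)
    (fun z hz => G.exists_equiv_chartCoframe hb hz) (x.map_source hps)
  set e := (chartAt R7 p).trans Ψ with he
  have hes : ∀ q ∈ e.source, q ∈ x.source ∧ x q ∈ Ψ.source := fun q hq => by
    rw [he, OpenPartialHomeomorph.trans_source] at hq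
    refine ⟨?_, hq.2⟩
    rw [hx, extChartAt_source]; exact hq.1
  have het : ∀ y ∈ e.target, y ∈ Ψ.target ∧ Ψ.symm y ∈ x.target := fun y hy => by
    rw [he, OpenPartialHomeomorph.trans_target] at hy
    exact ⟨hy.1, hsub (Ψ.map_target hy.1)⟩
  refine ⟨e, ?_, ?_, ?_⟩
  · refine e.mem_maximalAtlas_of_contMDiffOn (fun q hq => ?_) (fun y hy => ?_)
    · obtain ⟨h1, h2⟩ := hes q hq
      exact (ContMDiffAt.comp q (g := Ψ) (f := x)
        (hΨ.contDiffAt (Ψ.open_source.mem_nhds h2)).contMDiffAt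
        (contMDiffAt_chart h1)).contMDiffWithinAt
    · obtain ⟨h1, h2⟩ := het y hy
      exact (ContMDiffAt.comp y (g := x.symm) (f := Ψ.symm) (contMDiffAt_chart_symm h2)
        (hΨs.contDiffAt (Ψ.open_target.mem_nhds h1)).contMDiffAt).contMDiffWithinAt
  · rw [he, OpenPartialHomeomorph.trans_source]
    exact ⟨mem_chart_source R7 p, hpΨ⟩
  · intro q hq
    obtain ⟨h1, h2⟩ := hes q hq
    -- The primitive of the chart coframe, composed with the chart, has the adapted coframe itself
    -- as differential, and that coframe is orthonormal.
    have hD : ∀ X : TangentSpace (𝓡 7) q,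
        mfderiv (𝓡 7) 𝓘(ℝ, R7) e q X = G.coframe w q X := by
      intro X
      have h3 := HasMFDerivAt.comp q (g := Ψ) (f := x) (hd _ h2).hasMFDerivAt
        ((contMDiffAt_chart h1).mdifferentiableAt (by simp)).hasMFDerivAt
      have h4 : mfderiv (𝓡 7) 𝓘(ℝ, R7) e q X =
        G.chartCoframe w p (x q) (mfderiv (𝓡 7) 𝓘(ℝ, R7) x q X) := DFunLike.congr_fun h3.mfderiv X
      have h5 : ∀ q' : M, q' = q → ∀ Y Y' : R7, Y = Y' → (G.coframe w q' : R7 → R7) Y =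
        (G.coframe w q : R7 → R7) Y' := by rintro _ rfl Y _ rfl; rfl
      exact h4.trans (h5 _ (x.left_inv h1) _ _ (paramDeriv_mfderiv_chart h1 X))
    intro X Y
    rw [hD, hD, G.inner_coframe hb]

end Isometry

/-! ### The matrix of inner products of the generators -/

section Gram

variable {M : Type*} [TopologicalSpace M] [ChartedSpace R7 M] [MulAction Torus3 M]
  (G : G2Structure M)

theorem G2Structure.metric_infAction (p : M) (u v : Fin 3 → ℝ) :
    G.metric p (infAction p u) (infAction p v) = u ⬝ᵥ (G.B p).mulVec v := by
  have hT : ∀ u : Fin 3 → ℝ, G.frame p (infAction p u) =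
      ∑ i, u i • G.frame p (infAction p (Pi.single i 1)) := fun u => by
    conv_lhs => rw [pi_eq_sum_univ' u, map_sum, map_sum]
    simp only [map_smul]
  rw [G2Structure.metric, hT u, hT v]
  simp only [sum_inner, inner_sum, inner_smul_left, inner_smul_right, dotProduct, Matrix.mulVec,
    Finset.mul_sum, conj_trivial]
  rw [Finset.sum_comm]
  refine Finset.sum_congr rfl fun i _ => Finset.sum_congr rfl fun j _ => ?_
  simp only [G2Structure.B, Matrix.of_apply, G2Structure.metric]
  ring

theorem G2Structure.mem_regularSet_iff (p : M) : p ∈ regularSet M ↔ IsUnit (G.B p).det := by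
  change Function.Injective (infAction p) ↔ _
  rw [isUnit_iff_ne_zero, ← not_iff_not, not_not, ← Matrix.exists_mulVec_eq_zero_iff,
    injective_iff_map_eq_zero]
  push Not
  refine exists_congr fun v => ?_
  rw [and_comm]
  refine and_congr_right fun _ => ⟨fun h => ?_, fun h => ?_⟩
  · refine dotProduct_eq_zero _ fun u => ?_
    rw [dotProduct_comm, ← G.metric_infAction, h, G2Structure.metric, map_zero, inner_zero_right]
  · have h1 := G.metric_infAction p v v
    rw [h, dotProduct_zero, G2Structure.metric] at h1
    exact (G.frame p).map_eq_zero_iff.1 (inner_self_eq_zero.1 h1)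

theorem G2Structure.exists_orthonormal_of_mem_regularSet {p : M} (hp : p ∈ regularSet M) :
    ∃ w : Fin 3 → Fin 3 → ℝ, ∀ i j,
      G.metric p (infAction p (w i)) (infAction p (w j)) = if i = j then 1 else 0 := by
  set T : (Fin 3 → ℝ) →ₗ[ℝ] R7 :=
    ((G.frame p : TangentSpace (𝓡 7) p →L[ℝ] R7) ∘L infAction p).toLinearMap
  have hT : Function.Injective T := (G.frame p).injective.comp hp
  have hr : Module.finrank ℝ (LinearMap.range T) = 3 := by
    rw [LinearMap.finrank_range_of_inj hT]; simp
  set b := (stdOrthonormalBasis ℝ (LinearMap.range T)).reindex (finCongr hr)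
  choose w hw using fun i => (b i).2
  refine ⟨w, fun i j => ?_⟩
  rw [← orthonormal_iff_ite.1 b.orthonormal i j, Submodule.coe_inner, ← hw i, ← hw j]
  rfl

variable [IsManifold (𝓡 7) ∞ M]
  [ContMDiffSMul ((𝓡 1).prod ((𝓡 1).prod (𝓡 1))) (𝓡 7) ∞ Torus3 M]

theorem G2Structure.continuous_B : Continuous G.B := by
  refine continuous_matrix fun i j => continuous_iff_continuousAt.2 fun p => ?_
  set x := extChartAt (𝓡 7) p with hx
  have hps : p ∈ x.source := mem_extChartAt_source p
  have hy := x.map_source hps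
  have hg : ∀ v a, ContinuousAt (fun z => chartGenerator p v z a) (x p) := fun v a =>
    ((contDiffAt_piLp 2).1 (contDiffAt_chartGenerator hy v) a).continuousAt
  have hc : ContinuousAt (fun z => ∑ a, ∑ b, chartGenerator p (Pi.single i 1) z a *
      chartGenerator p (Pi.single j 1) z b * metricMatrix G.metric p z a b) (x p) :=
    tendsto_finsetSum _ fun a _ => tendsto_finsetSum _ fun b _ =>
      ((hg _ a).mul (hg _ b)).mul (G.contDiffAt_metricMatrix hy a b).continuousAt
  have hcx : ContinuousAt x p := (contMDiffAt_chart hps).continuousAt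
  refine (ContinuousAt.comp hc hcx).congr ?_
  filter_upwards [(isOpen_extChartAt_source p).mem_nhds hps] with q hq
  simp only [Function.comp]
  rw [← G.inner_chartFrame]
  have h := fun v => paramDeriv_chartGenerator (x.map_source hq) v
  have h' : ∀ v, G.chartFrame p (x q) (chartGenerator p v (x q)) = G.frame (x.symm (x q))
      (infAction (x.symm (x q)) v) := fun v => by rw [← h]; rfl
  rw [h', h', x.left_inv hq]
  rfl

/-- `M₀` is both the locus `B C = 1`, where `C` is the constant value of `V`, and the locus `det B ≠
0`. Continuity of `B` makes the first closed and the second open. -/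
theorem G2Structure.regularSet_eq_univ [T2Space M] [ConnectedSpace M] [FaithfulSMul Torus3 M]
    {C : Matrix (Fin 3) (Fin 3) ℝ} (hC : ∀ p ∈ regularSet M, G.V p = C) :
    regularSet M = Set.univ := by
  refine IsClopen.eq_univ ⟨?_, ?_⟩ regularSet_nonempty
  · have h : regularSet M = {p | G.B p * C = 1} := by
      ext p
      refine ⟨fun hp => ?_, fun hp => ?_⟩
      · have h1 := (G.mem_regularSet_iff p).1 hp
        rw [Set.mem_ofPred_eq, ← hC p hp]
        exact Matrix.mul_nonsing_inv _ h1
      · exact (G.mem_regularSet_iff p).2 (Matrix.isUnit_det_of_right_inverse hp)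
    rw [h]
    exact isClosed_eq (G.continuous_B.matrix_mul continuous_const) continuous_const
  · have h : regularSet M = {p | (G.B p).det ≠ 0} := by
      ext p
      rw [G.mem_regularSet_iff, isUnit_iff_ne_zero]
      rfl
    rw [h]
    exact isOpen_ne_fun G.continuous_B.matrix_det continuous_const

/-- Inner products of generators depend only on `B`, which is now constant, so a basis that is
orthonormal at one point is orthonormal at all. -/
theorem G2Structure.exists_isOrthonormalAction [T2Space M] [ConnectedSpace M]
    [FaithfulSMul Torus3 M] {C : Matrix (Fin 3) (Fin 3) ℝ} (hC : ∀ p ∈ regularSet M, G.V p = C) :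
    ∃ w, G.IsOrthonormalAction w := by
  have hreg : ∀ p, p ∈ regularSet M := fun p => by rw [G.regularSet_eq_univ hC]; trivial
  have hB : ∀ p, G.B p = C⁻¹ := fun p => by
    rw [← hC p (hreg p), G2Structure.V, Matrix.nonsing_inv_nonsing_inv _
      ((G.mem_regularSet_iff p).1 (hreg p))]
  obtain ⟨p₀⟩ := (inferInstance : Nonempty M)
  obtain ⟨w, hw⟩ := G.exists_orthonormal_of_mem_regularSet (hreg p₀)
  refine ⟨w, fun p i j => ?_⟩
  rw [← hw i j, G.metric_infAction, G.metric_infAction, hB, hB]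

end Gram

theorem mainTheorem11 {M : Type*} [TopologicalSpace M] [T2Space M] [SecondCountableTopology M]
    [ConnectedSpace M] [ChartedSpace R7 M] [IsManifold (𝓡 7) ∞ M] [MulAction Torus3 M]
    (G : G2Structure M) (hG : G.IsToric)
    (hV : ∃ C : Matrix (Fin 3) (Fin 3) ℝ, ∀ p ∈ regularSet M, G.V p = C) :
    IsFlat G.metric ∧ IsLocallyIsometricToR7 G.metric := by
  have := hG.smooth_action
  have := hG.effective
  obtain ⟨C, hC⟩ := hV
  obtain ⟨w, hw⟩ := G.exists_isOrthonormalAction hC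
  exact ⟨hw.isFlat hG.torsionFree hG.invariant hG.multiHamiltonian_form
      hG.multiHamiltonian_starForm,
    hw.isLocallyIsometricToR7 hG.torsionFree hG.invariant hG.multiHamiltonian_form
      hG.multiHamiltonian_starForm⟩

end
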